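/- **Conventions.** Let $k$ be an algebraically closed field of characteristic $0$, let $U$ and $H$ be finite dimensional semisimple Hopf algebras over $k$, and let $H^{*\mathrm{cop}}$ be the dual Hopf algebra of $H$ with convolution product and opposite comultiplication. Let $f : U \to H^{*\mathrm{cop}}$ be a surjective morphism of Hopf algebras, and put $\lambda(u,h) = f(u)(h)$ and $\lambda^{-1}(u,h)=\lambda(S(u),h)$. Let $A := D_f(U,H)$ be the generalized quantum double: the coalgebra $U\otimes H$ (with $u\otimes a$ written $u\bowtie a$) with the multiplication $$(u\bowtie a)(v\bowtie b)=\lambda(v_1,a_1)\,\lambda^{-1}(v_3,a_3)\;uv_2\bowtie a_2b .$$ For a Hopf algebra $X$ let $K(X)$ be its largest central Hopf subalgebra. Suppose that $K(U)= kG^*$ and $K(H^{*\mathrm{cop}})= kF^*$ for finite groups $G$, $F$, where $kG^*$ (resp. $kF^*$) is the Hopf algebra of functions on the group, with basis $\{p_g\}_{g\in G}$ (resp. $\{q_x\}_{x\in F}$) of indicator functions. For $g \in G$ write $g$ also for the one dimensional $kG^*$-module $kp_g$, on which $\varphi\in kG^*$ acts as $\varphi(g)$. View $K(U)=kG^*$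 inside $A$ via $u\mapsto u\bowtie 1$. If $B$ is a normal Hopf subalgebra of $A$, $M$ is a $B$-module and $W$ is a finite dimensional $A^*$-module, that is a right $A$-comodule $w\mapsto w_0\otimes w_1$, then $W\otimes M$ is a $B$-module by $b(w\otimes m)=w_0\otimes (S(w_1)bw_2)m$. The *conjugates* of an irreducible $B$-module $M$ in $A$ are the irreducible constituents of the modules $W\otimes M$ with $W$ an irreducible $A^*$-module. The module $W$ *stabilizes* $M$ if the character of $W\otimes M$ is $\dim(W)$ times that of $M$. The *stabilizer* $Z_A(M)$ is the sum of the coefficient coalgebras $C_W=\operatorname{span}\{\xi(w_0)w_1 : w\in W,\ \xi\in W^*\}$ of the $A^*$-modules $W$ that stabilize $M$. For $x\in F$ let $(\mathcal C_2)_x$ be the category of the finite dimensional $H^{*\mathrm{cop}}$-modules on which every $\psi\in kF^*=K(H^{*\mathrm{cop}})$ acts as the scalar $\psi(x)$; these are the components of the universal grading of $\mathcal C_2=\operatorname{Rep}(H^{*\mathrm{cop}})$. For a Hopf subalgebra $L\subseteq H$, regard $\operatorname{Rep}(L^*)$ as the category of the finite dimensional $H^*$-modules on which $H^*$ acts through the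 restriction $H^*\to L^*$. **Theorem.** There is a group morphism $f^*:F\to G$ with $f(p_g)=\sum_{x\in F,\ f^*(x)=g} q_x$ for all $g\in G$, and $K(U)$ is a normal Hopf subalgebra of $A$. For every $g\in G$: 1. The conjugates of $g$ in $A$ are exactly the elements $f^*(x)\,g\,f^*(x)^{-1}$ with $x\in F$. Moreover, for every irreducible $A^*$-module $W$ there is an $x\in F$ such that $W\otimes kp_g$ is isomorphic to the direct sum of $\dim W$ copies of $kp_{f^*(x)gf^*(x)^{-1}}$. 2. There is a unique Hopf subalgebra $L(g)$ of $H$ with $$\operatorname{Rep}(L(g)^*)=\bigoplus_{\{x\in F\,:\, f^*(x)\in C_G(g)\}}(\mathcal C_2)_x .$$ The stabilizer $Z_A(g)$ is a Hopf subalgebra of $A$, an irreducible $A^*$-module $W$ stabilizes $g$ if and only if $C_W\subseteq Z_A(g)$, and $$Z_A(g)=U\bowtie L(g):=\operatorname{span}\{u\bowtie l : u\in U,\ l\in L(g)\}.$$ -/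

import Mathlib

open TensorProduct Coalgebra HopfAlgebra WithConv

universe u

noncomputable section

/-- The dual algebra `A^*` of a coalgebra `A`, with the convolution product
`(α β)(a) = α(a₁) β(a₂)`. -/
abbrev ConvDual (k A : Type u) [CommSemiring k] [AddCommMonoid A] [Module k A] : Type u :=
  WithConv (A →ₗ[k] k)

/-- The dual `H^{* cop}` of a finite dimensional bialgebra: as an algebra it is `H^*` with the
convolution product; its comultiplication is opposite to the one dual to the
multiplication of `H`. -/
def DualCop (k H : Type u) [Field k] [Ring H] [Bialgebra k H] : Type u := ConvDual k H

namespace DualCop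

variable {k H : Type u} [Field k] [Ring H] [Bialgebra k H]

instance : Ring (DualCop k H) := inferInstanceAs (Ring (ConvDual k H))
instance : Algebra k (DualCop k H) := inferInstanceAs (Algebra k (ConvDual k H))

/-- The functional on `H` underlying an element of `H^{* cop}`. -/
def toDual : DualCop k H ≃ₗ[k] (H →ₗ[k] k) := WithConv.linearEquiv k (H →ₗ[k] k)

lemma toDual_mul (α β : DualCop k H) (h : H) :
    toDual (α * β) h =
      LinearMap.mul' k k (TensorProduct.map (toDual α) (toDual β) (comul h)) := rfl

lemma toDual_mul_repr {ι : Type*} (α β : DualCop k H) {a : H} (r : Coalgebra.Repr k a ι) :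
    toDual (α * β) a = ∑ i ∈ r.index, toDual α (r.left i) * toDual β (r.right i) :=
  r.convMul_apply _ _

lemma toDual_one (h : H) : toDual (1 : DualCop k H) h = counit (R := k) h := rfl

variable [FiniteDimensional k H]

/-- The identification of `H^* ⊗ H^*` with the dual of `H ⊗ H`. -/
def pair : DualCop k H ⊗[k] DualCop k H ≃ₗ[k] (H ⊗[k] H →ₗ[k] k) :=
  (TensorProduct.congr toDual toDual).trans (dualDistribEquiv k H H)

lemma pair_tmul (α β : DualCop k H) (a b : H) :
    pair (α ⊗ₜ β) (a ⊗ₜ b) = toDual α a * toDual β b := rfl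

/-- `Δ(α) = α₁ ⊗ α₂` is determined by `α₁(a) α₂(b) = α(b a)`; the counit is `α ↦ α(1)`. -/
instance : CoalgebraStruct k (DualCop k H) where
  comul := pair.symm.toLinearMap ∘ₗ
    (LinearMap.mul' k H ∘ₗ (TensorProduct.comm k H H).toLinearMap).dualMap ∘ₗ
      toDual.toLinearMap
  counit := LinearMap.applyₗ (1 : H) ∘ₗ toDual.toLinearMap

lemma counit_apply (α : DualCop k H) : counit (R := k) α = toDual α 1 := rfl

lemma pair_comul (α : DualCop k H) (a b : H) :
    pair (comul (R := k) α) (a ⊗ₜ b) = toDual α (b * a) := by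
  simp [comul]

/-- The identification of `H^* ⊗ H^* ⊗ H^*` with the dual of `H ⊗ H ⊗ H`. -/
def pairThree : DualCop k H ⊗[k] (DualCop k H ⊗[k] DualCop k H) ≃ₗ[k]
    (H ⊗[k] (H ⊗[k] H) →ₗ[k] k) :=
  (TensorProduct.congr toDual pair).trans (dualDistribEquiv k H (H ⊗[k] H))

lemma pairThree_tmul (α : DualCop k H) (s : DualCop k H ⊗[k] DualCop k H) (a b c : H) :
    pairThree (α ⊗ₜ s) (a ⊗ₜ (b ⊗ₜ c)) = toDual α a * pair s (b ⊗ₜ c) := rfl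

lemma pairThree_assoc_tmul (s : DualCop k H ⊗[k] DualCop k H) (β : DualCop k H) (a b c : H) :
    pairThree (TensorProduct.assoc k _ _ _ (s ⊗ₜ β)) (a ⊗ₜ (b ⊗ₜ c)) =
      pair s (a ⊗ₜ b) * toDual β c := by
  induction s with
  | zero => simp
  | add x y hx hy => simp only [add_tmul, map_add, LinearMap.add_apply, hx, hy, add_mul]
  | tmul x y => simp [pairThree_tmul, pair_tmul, mul_assoc]

lemma pairThree_lTensor (t : DualCop k H ⊗[k] DualCop k H) (a b c : H) :
    pairThree ((comul (R := k)).lTensor (DualCop k H) t) (a ⊗ₜ (b ⊗ₜ c)) =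
      pair t (a ⊗ₜ (c * b)) := by
  induction t with
  | zero => simp
  | add x y hx hy => simp only [map_add, LinearMap.add_apply, hx, hy]
  | tmul x y => simp [pairThree_tmul, pair_tmul, pair_comul]

lemma pairThree_rTensor (t : DualCop k H ⊗[k] DualCop k H) (a b c : H) :
    pairThree (TensorProduct.assoc k _ _ _ ((comul (R := k)).rTensor (DualCop k H) t))
      (a ⊗ₜ (b ⊗ₜ c)) = pair t ((b * a) ⊗ₜ c) := by
  induction t with
  | zero => simp
  | add x y hx hy => simp only [map_add, LinearMap.add_apply, hx, hy]
  | tmul x y => simp [pairThree_assoc_tmul, pair_tmul, pair_comul]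

lemma lid_rTensor_counit (t : DualCop k H ⊗[k] DualCop k H) (b : H) :
    toDual (TensorProduct.lid k _ ((counit (R := k)).rTensor (DualCop k H) t)) b =
      pair t (1 ⊗ₜ b) := by
  induction t with
  | zero => simp
  | add x y hx hy => simp only [map_add, LinearMap.add_apply, hx, hy]
  | tmul x y => simp [pair_tmul, counit_apply]

lemma rid_lTensor_counit (t : DualCop k H ⊗[k] DualCop k H) (b : H) :
    toDual (TensorProduct.rid k _ ((counit (R := k)).lTensor (DualCop k H) t)) b =
      pair t (b ⊗ₜ 1) := by
  induction t with
  | zero => simp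
  | add x y hx hy => simp only [map_add, LinearMap.add_apply, hx, hy]
  | tmul x y => simp [pair_tmul, counit_apply, mul_comm]

instance : Coalgebra k (DualCop k H) where
  coassoc := by
    ext α
    apply pairThree.injective
    apply TensorProduct.ext'
    intro a t
    induction t with
    | zero => simp
    | add x y hx hy => simp only [tmul_add, map_add, hx, hy]
    | tmul b c =>
      simp [pairThree_lTensor, pairThree_rTensor, pair_comul, mul_assoc]
  rTensor_counit_comp_comul := by
    ext α
    apply (TensorProduct.lid k _).injective
    apply toDual.injective
    ext b
    simp [lid_rTensor_counit, pair_comul]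
  lTensor_counit_comp_comul := by
    ext α
    apply (TensorProduct.rid k _).injective
    apply toDual.injective
    ext b
    simp [rid_lTensor_counit, pair_comul]

lemma pair_mul (s t : DualCop k H ⊗[k] DualCop k H) (z : H ⊗[k] H) :
    pair (s * t) z = LinearMap.mul' k k (TensorProduct.map (pair s) (pair t) (comul z)) := by
  induction s with
  | zero => simp
  | add x y hx hy =>
    simp only [add_mul, map_add, LinearMap.add_apply, hx, hy, TensorProduct.map_add_left]
  | tmul x y =>
    induction t with
    | zero => simp
    | add x' y' hx hy =>
      simp only [mul_add, map_add, LinearMap.add_apply, hx, hy, TensorProduct.map_add_right]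
    | tmul x' y' =>
      induction z with
      | zero => simp
      | add x y hx hy => simp only [map_add, hx, hy]
      | tmul a b =>
        rw [Algebra.TensorProduct.tmul_mul_tmul, pair_tmul, toDual_mul, toDual_mul, comul_tmul]
        generalize comul (R := k) a = p
        generalize comul (R := k) b = q
        induction p with
        | zero => simp
        | add x y hx hy => simp only [map_add, add_tmul, add_mul, hx, hy]
        | tmul a₁ a₂ =>
          induction q with
          | zero => simp
          | add x y hx hy => simp only [map_add, tmul_add, mul_add, hx, hy]
          | tmul b₁ b₂ => simp [pair_tmul]; ring

lemma comul_mul_aux (α β : DualCop k H) :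
    comul (R := k) (α * β) = comul (R := k) α * comul (R := k) β := by
  apply pair.injective
  apply TensorProduct.ext'
  intro a b
  rw [pair_comul, toDual_mul, pair_mul, comul_tmul, Bialgebra.comul_mul]
  generalize comul (R := k) a = p
  generalize comul (R := k) b = q
  induction p with
  | zero => simp
  | add x y hx hy => simp only [map_add, add_tmul, mul_add, hx, hy]
  | tmul a₁ a₂ =>
    induction q with
    | zero => simp
    | add x y hx hy => simp only [map_add, tmul_add, add_mul, hx, hy]
    | tmul b₁ b₂ => simp [pair_comul]

lemma comul_one_aux : comul (R := k) (1 : DualCop k H) = 1 := by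
  apply pair.injective
  apply TensorProduct.ext'
  intro a b
  rw [pair_comul, Algebra.TensorProduct.one_def, pair_tmul]
  simp [toDual_one, mul_comm]

instance : Bialgebra k (DualCop k H) :=
  Bialgebra.mk' k (DualCop k H)
    (by simp [counit_apply, toDual_one])
    (by intro α β; simp [counit_apply, toDual_mul, Algebra.TensorProduct.one_def])
    comul_one_aux
    (comul_mul_aux _ _)

end DualCop

section Actions

variable {k U : Type u} [Field k] [Ring U] [Bialgebra k U]

/-- The right action of `U^*` on `U`: `u ↦ φ(u₁) u₂`. -/
def rAct : ConvDual k U →ₗ[k] Module.End k U :=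
  LinearMap.mk₂ k (fun φ u => TensorProduct.lid k U (φ.ofConv.rTensor U (comul (R := k) u)))
    (by intro φ ψ u; simp [LinearMap.rTensor_add])
    (by intro c φ u; simp [LinearMap.rTensor_smul])
    (by intro φ u v; simp)
    (by intro c φ u; simp)

/-- The left action of `U^*` on `U`: `u ↦ u₁ φ(u₂)`. -/
def lAct : ConvDual k U →ₗ[k] Module.End k U :=
  LinearMap.mk₂ k (fun φ u => TensorProduct.rid k U (φ.ofConv.lTensor U (comul (R := k) u)))
    (by intro φ ψ u; simp [LinearMap.lTensor_add])
    (by intro c φ u; simp [LinearMap.lTensor_smul])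
    (by intro φ u v; simp)
    (by intro c φ u; simp)

lemma rAct_apply (φ : ConvDual k U) (u : U) :
    rAct φ u = TensorProduct.lid k U (φ.ofConv.rTensor U (comul (R := k) u)) := rfl

lemma lAct_apply (φ : ConvDual k U) (u : U) :
    lAct φ u = TensorProduct.rid k U (φ.ofConv.lTensor U (comul (R := k) u)) := rfl

lemma comul_rAct (φ : ConvDual k U) (u : U) :
    comul (R := k) (rAct φ u) = (rAct φ).rTensor U (comul (R := k) u) := by
  have h : ∀ t : U ⊗[k] U, comul (R := k) (TensorProduct.lid k U (φ.ofConv.rTensor U t)) =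
      (TensorProduct.lid k U ∘ₗ φ.ofConv.rTensor U).rTensor U
        ((TensorProduct.assoc k U U U).symm ((comul (R := k)).lTensor U t)) := by
    intro t
    induction t with
    | zero => simp
    | add x y hx hy => simp only [map_add, hx, hy]
    | tmul x y =>
      simp only [LinearMap.rTensor_tmul, lid_tmul, map_smul, LinearMap.lTensor_tmul]
      generalize comul (R := k) y = s
      induction s with
      | zero => simp
      | add x y hx hy => simp only [tmul_add, smul_add, map_add, hx, hy]
      | tmul y z => simp [smul_tmul']
  rw [rAct_apply, h, coassoc_symm_apply]
  generalize comul (R := k) u = t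
  induction t with
  | zero => simp
  | add x y hx hy => simp only [map_add, hx, hy]
  | tmul x y => simp [rAct_apply]

lemma comul_lAct (φ : ConvDual k U) (u : U) :
    comul (R := k) (lAct φ u) = (lAct φ).lTensor U (comul (R := k) u) := by
  have h : ∀ t : U ⊗[k] U, comul (R := k) (TensorProduct.rid k U (φ.ofConv.lTensor U t)) =
      (TensorProduct.rid k U ∘ₗ φ.ofConv.lTensor U).lTensor U
        ((TensorProduct.assoc k U U U) ((comul (R := k)).rTensor U t)) := by
    intro t
    induction t with
    | zero => simp
    | add x y hx hy => simp only [map_add, hx, hy]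
    | tmul x y =>
      simp only [LinearMap.lTensor_tmul, rid_tmul, map_smul, LinearMap.rTensor_tmul]
      generalize comul (R := k) x = s
      induction s with
      | zero => simp
      | add x y hx hy => simp only [add_tmul, smul_add, map_add, hx, hy]
      | tmul y z => simp
  rw [lAct_apply, h, coassoc_apply]
  generalize comul (R := k) u = t
  induction t with
  | zero => simp
  | add x y hx hy => simp only [map_add, hx, hy]
  | tmul x y => simp [lAct_apply]

/-- `u₁ φ(u₂) ⊗ u₃ = u₁ ⊗ φ(u₂) u₃`. -/
lemma lAct_rTensor_comul (φ : ConvDual k U) (u : U) :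
    (lAct φ).rTensor U (comul (R := k) u) = (rAct φ).lTensor U (comul (R := k) u) := by
  have h₁ : ∀ t : U ⊗[k] U, (lAct φ).rTensor U t =
      (TensorProduct.lid k U ∘ₗ φ.ofConv.rTensor U).lTensor U
        ((TensorProduct.assoc k U U U) ((comul (R := k)).rTensor U t)) := by
    intro t
    induction t with
    | zero => simp
    | add x y hx hy => simp only [map_add, hx, hy]
    | tmul x y =>
      simp only [LinearMap.rTensor_tmul, lAct_apply]
      generalize comul (R := k) x = s
      induction s with
      | zero => simp
      | add x y hx hy => simp only [add_tmul, map_add, hx, hy]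
      | tmul y z => simp [smul_tmul]
  rw [h₁, coassoc_apply]
  generalize comul (R := k) u = t
  induction t with
  | zero => simp
  | add x y hx hy => simp only [map_add, hx, hy]
  | tmul x y => simp [rAct_apply]

lemma convDual_mul_apply_rAct (φ ψ : ConvDual k U) (u : U) :
    (φ * ψ).ofConv u = ψ.ofConv (rAct φ u) := by
  rw [rAct_apply, LinearMap.convMul_def]
  simp only [LinearMap.comp_apply]
  generalize comul (R := k) u = t
  induction t with
  | zero => simp
  | add x y hx hy => simp only [map_add, hx, hy]
  | tmul x y => simp

lemma convDual_mul_apply_lAct (φ ψ : ConvDual k U) (u : U) :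
    (φ * ψ).ofConv u = φ.ofConv (lAct ψ u) := by
  rw [lAct_apply, LinearMap.convMul_def]
  simp only [LinearMap.comp_apply]
  generalize comul (R := k) u = t
  induction t with
  | zero => simp
  | add x y hx hy => simp only [map_add, hx, hy]
  | tmul x y => simp [mul_comm]

lemma rAct_mul (φ ψ : ConvDual k U) : rAct (φ * ψ) = rAct ψ * rAct φ := by
  ext u
  rw [Module.End.mul_apply, rAct_apply ψ, comul_rAct, rAct_apply]
  generalize comul (R := k) u = t
  induction t with
  | zero => simp
  | add x y hx hy => simp only [map_add, hx, hy]
  | tmul x y => simp only [LinearMap.rTensor_tmul, lid_tmul, convDual_mul_apply_rAct]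

lemma lAct_mul (φ ψ : ConvDual k U) : lAct (φ * ψ) = lAct φ * lAct ψ := by
  ext u
  rw [Module.End.mul_apply, lAct_apply φ, comul_lAct, lAct_apply]
  generalize comul (R := k) u = t
  induction t with
  | zero => simp
  | add x y hx hy => simp only [map_add, hx, hy]
  | tmul x y => simp only [LinearMap.lTensor_tmul, rid_tmul, convDual_mul_apply_lAct]

lemma rAct_one : rAct (1 : ConvDual k U) = 1 := by
  ext u
  have : (1 : ConvDual k U).ofConv = counit := rfl
  rw [rAct_apply, this, rTensor_counit_comul]
  simp

lemma lAct_one : lAct (1 : ConvDual k U) = 1 := by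
  ext u
  have : (1 : ConvDual k U).ofConv = counit := rfl
  rw [lAct_apply, this, lTensor_counit_comul]
  simp

lemma rAct_lAct_commute (φ ψ : ConvDual k U) : Commute (rAct φ) (lAct ψ) := by
  ext u
  rw [Module.End.mul_apply, Module.End.mul_apply, rAct_apply, comul_lAct, rAct_apply]
  generalize comul (R := k) u = t
  induction t with
  | zero => simp
  | add x y hx hy => simp only [map_add, hx, hy]
  | tmul x y => simp

end Actions

section Pairing

variable {k U H : Type u} [Field k] [Ring U] [HopfAlgebra k U] [Ring H] [HopfAlgebra k H]
  [FiniteDimensional k H]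

/-- The skew pairing `λ(u, h) = f(u)(h)`, as the map `h ↦ λ(-, h)`. -/
def lam (f : U →ₐc[k] DualCop k H) : H →ₗ[k] ConvDual k U :=
  (WithConv.linearEquiv k (U →ₗ[k] k)).symm.toLinearMap ∘ₗ
    (DualCop.toDual.toLinearMap ∘ₗ (f : U →ₗ[k] DualCop k H)).flip

/-- The convolution inverse `λ⁻¹(u, h) = λ(S u, h)`, as the map `h ↦ λ⁻¹(-, h)`. -/
def lamInv (f : U →ₐc[k] DualCop k H) : H →ₗ[k] ConvDual k U :=
  (WithConv.linearEquiv k (U →ₗ[k] k)).symm.toLinearMap ∘ₗ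
    (DualCop.toDual.toLinearMap ∘ₗ (f : U →ₗ[k] DualCop k H) ∘ₗ antipode k).flip

variable (f : U →ₐc[k] DualCop k H)

lemma lam_apply (h : H) (u : U) : (lam f h).ofConv u = DualCop.toDual (f u) h := rfl

lemma lamInv_apply (h : H) (u : U) :
    (lamInv f h).ofConv u = DualCop.toDual (f (antipode k u)) h := rfl

lemma lam_one : lam f 1 = 1 := by
  ext u
  rw [lam_apply, ← DualCop.counit_apply]
  exact CoalgHomClass.counit_comp_apply f u

lemma lamInv_one : lamInv f 1 = 1 := by
  ext u
  rw [lamInv_apply, ← DualCop.counit_apply]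
  exact (CoalgHomClass.counit_comp_apply f _).trans (counit_antipode u)

lemma pair_map (t : U ⊗[k] U) (a b : H) :
    DualCop.pair (TensorProduct.map (f : U →ₗ[k] DualCop k H) (f : U →ₗ[k] DualCop k H) t)
      (a ⊗ₜ b) =
    LinearMap.mul' k k (TensorProduct.map (lam f a).ofConv (lam f b).ofConv t) := by
  induction t with
  | zero => simp
  | add x y hx hy => simp only [map_add, LinearMap.add_apply, hx, hy]
  | tmul x y => simp [DualCop.pair_tmul, lam_apply]

lemma lam_mul (a b : H) : lam f (a * b) = lam f b * lam f a := by
  ext u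
  rw [lam_apply, ← DualCop.pair_comul]
  have := CoalgHomClass.map_comp_comul_apply f u
  rw [← this]
  exact pair_map f _ b a

lemma lamInv_conv_lam : toConv (lamInv f) * toConv (lam f) = 1 := by
  ext a u
  have h := congrArg (fun x => DualCop.toDual (f x) a)
    (sum_antipode_mul_eq_algebraMap_counit (ℛ k u))
  simp only [map_sum, map_mul, LinearMap.sum_apply, DualCop.toDual_mul_repr _ _ (ℛ k a)] at h
  rw [(ℛ k a).convMul_apply]
  simp only [ofConv_sum, LinearMap.sum_apply, (ℛ k u).convMul_apply]
  rw [Finset.sum_comm]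
  refine h.trans ?_
  rw [AlgHomClass.commutes, Algebra.algebraMap_eq_smul_one, map_smul, LinearMap.smul_apply,
    DualCop.toDual_one]
  simp [mul_comm, Algebra.algebraMap_eq_smul_one]

lemma lam_conv_lamInv : toConv (lam f) * toConv (lamInv f) = 1 := by
  ext a u
  have h := congrArg (fun x => DualCop.toDual (f x) a)
    (sum_mul_antipode_eq_algebraMap_counit (ℛ k u))
  simp only [map_sum, map_mul, LinearMap.sum_apply, DualCop.toDual_mul_repr _ _ (ℛ k a)] at h
  rw [(ℛ k a).convMul_apply]
  simp only [ofConv_sum, LinearMap.sum_apply, (ℛ k u).convMul_apply]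
  rw [Finset.sum_comm]
  refine h.trans ?_
  rw [AlgHomClass.commutes, Algebra.algebraMap_eq_smul_one, map_smul, LinearMap.smul_apply,
    DualCop.toDual_one]
  simp [mul_comm, Algebra.algebraMap_eq_smul_one]

lemma lamInv_mul_lam {ι : Type*} {a : H} (r : Coalgebra.Repr k a ι) :
    ∑ i ∈ r.index, lamInv f (r.left i) * lam f (r.right i) =
      algebraMap k (ConvDual k U) (counit a) :=
  (r.convMul_apply (toConv (lamInv f)) (toConv (lam f))).symm.trans
    congr(($(lamInv_conv_lam f)).ofConv a)

lemma lam_mul_lamInv {ι : Type*} {a : H} (r : Coalgebra.Repr k a ι) :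
    ∑ i ∈ r.index, lam f (r.left i) * lamInv f (r.right i) =
      algebraMap k (ConvDual k U) (counit a) :=
  (r.convMul_apply (toConv (lam f)) (toConv (lamInv f))).symm.trans
    congr(($(lam_conv_lamInv f)).ofConv a)

lemma lamInv_mul (a b : H) : lamInv f (a * b) = lamInv f a * lamInv f b := by
  have key : toConv (lamInv f ∘ₗ LinearMap.mul' k H) =
      toConv (LinearMap.mul' k (ConvDual k U) ∘ₗ TensorProduct.map (lamInv f) (lamInv f)) := by
    apply left_inv_eq_right_inv (a := toConv (lam f ∘ₗ LinearMap.mul' k H))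
    · apply WithConv.ext
      apply TensorProduct.ext'
      intro a b
      refine (((ℛ k a).tmul (ℛ k b)).convMul_apply _ _).trans ?_
      have := lamInv_mul_lam f ((ℛ k a).mul (ℛ k b))
      refine this.trans ?_
      simp [mul_comm]
    · apply WithConv.ext
      apply TensorProduct.ext'
      intro a b
      refine (((ℛ k a).tmul (ℛ k b)).convMul_apply _ _).trans ?_
      have h : ∀ j i, (lam f ∘ₗ LinearMap.mul' k H) ((ℛ k a).left i ⊗ₜ (ℛ k b).left j) *
          (LinearMap.mul' k (ConvDual k U) ∘ₗ TensorProduct.map (lamInv f) (lamInv f))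
            ((ℛ k a).right i ⊗ₜ (ℛ k b).right j) =
          lam f ((ℛ k b).left j) * (lam f ((ℛ k a).left i) * lamInv f ((ℛ k a).right i)) *
            lamInv f ((ℛ k b).right j) := by
        intro j i
        simp [lam_mul, mul_assoc]
      refine (Finset.sum_product_right _ _ _).trans ?_
      refine (Finset.sum_congr rfl fun j _ => Finset.sum_congr rfl fun i _ => h j i).trans ?_
      simp only [← Finset.sum_mul, ← Finset.mul_sum, lam_mul_lamInv]
      simp only [← Algebra.commutes, mul_assoc]
      rw [← Finset.mul_sum, lam_mul_lamInv]
      simp [mul_comm]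
  exact congr(($key).ofConv (a ⊗ₜ b))

end Pairing

section Twist

variable {k U H : Type u} [Field k] [Ring U] [HopfAlgebra k U] [Ring H] [HopfAlgebra k H]
  [FiniteDimensional k H] (f : U →ₐc[k] DualCop k H)

/-- `h` acts on `U` by `u ↦ λ(u₁, h) u₂`. -/
def alphaHom : H →ₐ[k] Module.End k U :=
  AlgHom.ofLinearMap (rAct ∘ₗ lam f)
    (by simp [lam_one, rAct_one])
    (by intro a b; simp [lam_mul, rAct_mul])

/-- `h` acts on `U` by `u ↦ u₁ λ⁻¹(u₂, h)`. -/
def betaHom : H →ₐ[k] Module.End k U :=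
  AlgHom.ofLinearMap (lAct ∘ₗ lamInv f)
    (by simp [lamInv_one, lAct_one])
    (by intro a b; simp [lamInv_mul, lAct_mul])

lemma alphaHom_apply (h : H) : alphaHom f h = rAct (lam f h) := rfl
lemma betaHom_apply (h : H) : betaHom f h = lAct (lamInv f h) := rfl

/-- `b ⊗ c` acts on `U ⊗ H` by `u ⊗ a ↦ λ(u₁, b) u₂ ⊗ c a`. -/
def leftPartTwo : H ⊗[k] H →ₐ[k] Module.End k (U ⊗[k] H) :=
  (Module.endTensorEndAlgHom (R := k) (S := k) (A := k) (M := U) (N := H)).comp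
    (Algebra.TensorProduct.map (alphaHom f) (Algebra.lmul k H))

lemma leftPartTwo_tmul (b c : H) :
    leftPartTwo f (b ⊗ₜ c) = TensorProduct.map (alphaHom f b) (LinearMap.mulLeft k c) := rfl

/-- `h` acts on `U ⊗ H` by `u ⊗ a ↦ λ(u₁, h₁) u₂ ⊗ h₂ a`. -/
def leftPart : H →ₐ[k] Module.End k (U ⊗[k] H) :=
  (leftPartTwo f).comp (Bialgebra.comulAlgHom k H)

lemma leftPart_apply (h : H) : leftPart f h = leftPartTwo f (comul (R := k) h) := rfl

/-- `h` acts on `U ⊗ H` by `u ⊗ a ↦ u₁ λ⁻¹(u₂, h) ⊗ a`. -/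
def rightPart : H →ₐ[k] Module.End k (U ⊗[k] H) :=
  ((Module.endTensorEndAlgHom (R := k) (S := k) (A := k) (M := U) (N := H)).comp
    Algebra.TensorProduct.includeLeft).comp (betaHom f)

lemma rightPart_apply (h : H) : rightPart f h = (betaHom f h).rTensor H := rfl

lemma leftPart_rightPart_commute (a b : H) : Commute (leftPart f a) (rightPart f b) := by
  rw [leftPart_apply, rightPart_apply]
  generalize comul (R := k) a = t
  induction t with
  | zero => simp
  | add x y hx hy => rw [map_add]; exact hx.add_left hy
  | tmul x y =>
    apply TensorProduct.ext'
    intro u c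
    have h := congrArg (fun e => e u) (rAct_lAct_commute (lam f x) (lamInv f b))
    simp only [Module.End.mul_apply] at h
    simp [leftPartTwo_tmul, alphaHom_apply, betaHom_apply, h]

/-- Left multiplication by `h` in the generalized double:
`h · (u ⊗ a) = λ(u₁, h₁) u₂ ⊗ h₂ a λ⁻¹(u₃, h₃)`. -/
def actH : H →ₐ[k] Module.End k (U ⊗[k] H) :=
  (Algebra.TensorProduct.lift (leftPart f) (rightPart f)
    (leftPart_rightPart_commute f)).comp (Bialgebra.comulAlgHom k H)

lemma actH_apply (h : H) : actH f h =
    LinearMap.mul' k _ (TensorProduct.map (leftPart f).toLinearMap (rightPart f).toLinearMap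
      (comul (R := k) h)) := by
  change Algebra.TensorProduct.lift (leftPart f) (rightPart f) (leftPart_rightPart_commute f)
    (comul (R := k) h) = _
  generalize comul (R := k) h = t
  induction t with
  | zero => simp
  | add x y hx hy => simp only [map_add, hx, hy]
  | tmul x y => simp

/-- Left multiplication by `u` in the generalized double. -/
def actU : U →ₐ[k] Module.End k (U ⊗[k] H) :=
  (Module.endTensorEndAlgHom (R := k) (S := k) (A := k) (M := U) (N := H)).comp
    (Algebra.TensorProduct.includeLeft.comp (Algebra.lmul k U))

lemma actU_tmul (v u : U) (a : H) : actU (k := k) v (u ⊗ₜ[k] a) = (v * u) ⊗ₜ a := rfl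

/-- Left multiplication in the generalized double:
`(u ⊗ a)(v ⊗ b) = λ(v₁, a₁) u v₂ ⊗ a₂ b λ⁻¹(v₃, a₃)`. -/
def actD : U ⊗[k] H →ₗ[k] Module.End k (U ⊗[k] H) :=
  LinearMap.mul' k _ ∘ₗ TensorProduct.map actU.toLinearMap (actH f).toLinearMap

lemma actD_tmul (u : U) (a : H) : actD f (u ⊗ₜ a) = actU u * actH f a := rfl

lemma alphaHom_mul (a : H) (v w : U) : alphaHom f a (v * w) =
    LinearMap.mul' k U (TensorProduct.map ((alphaHom f).toLinearMap.flip v)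
      ((alphaHom f).toLinearMap.flip w) (comul (R := k) a)) := by
  have h : ∀ x y : U, (lam f a).ofConv (x * y) = ∑ i ∈ (ℛ k a).index,
      (lam f ((ℛ k a).left i)).ofConv x * (lam f ((ℛ k a).right i)).ofConv y := by
    intro x y
    rw [lam_apply, map_mul, DualCop.toDual_mul_repr _ _ (ℛ k a)]
    rfl
  rw [← (ℛ k a).eq]
  simp only [map_sum, TensorProduct.map_tmul, LinearMap.mul'_apply, LinearMap.flip_apply,
    AlgHom.toLinearMap_apply, alphaHom_apply, rAct_apply, Bialgebra.comul_mul]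
  generalize comul (R := k) v = s
  generalize comul (R := k) w = t
  induction s with
  | zero => simp
  | add x y hx hy => simp only [add_mul, map_add, hx, hy, Finset.sum_add_distrib]
  | tmul x x' =>
    induction t with
    | zero => simp
    | add x y hx hy => simp only [mul_add, map_add, hx, hy, Finset.sum_add_distrib]
    | tmul y y' =>
      simp [h, Finset.sum_smul, smul_smul, mul_comm]

lemma betaHom_mul (a : H) (v w : U) : betaHom f a (v * w) =
    LinearMap.mul' k U (TensorProduct.map ((betaHom f).toLinearMap.flip v)
      ((betaHom f).toLinearMap.flip w) (TensorProduct.comm k H H (comul (R := k) a))) := by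
  have h : ∀ x y : U, (lamInv f a).ofConv (x * y) = ∑ i ∈ (ℛ k a).index,
      (lamInv f ((ℛ k a).right i)).ofConv x * (lamInv f ((ℛ k a).left i)).ofConv y := by
    intro x y
    rw [lamInv_apply, antipode_mul_antidistrib, map_mul, DualCop.toDual_mul_repr _ _ (ℛ k a)]
    exact Finset.sum_congr rfl fun i _ => mul_comm _ _
  rw [← (ℛ k a).eq]
  simp only [map_sum, TensorProduct.map_tmul, LinearMap.mul'_apply, LinearMap.flip_apply,
    AlgHom.toLinearMap_apply, betaHom_apply, lAct_apply, Bialgebra.comul_mul,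
    TensorProduct.comm_tmul]
  generalize comul (R := k) v = s
  generalize comul (R := k) w = t
  induction s with
  | zero => simp
  | add x y hx hy => simp only [add_mul, map_add, hx, hy, Finset.sum_add_distrib]
  | tmul x x' =>
    induction t with
    | zero => simp
    | add x y hx hy => simp only [mul_add, map_add, hx, hy, Finset.sum_add_distrib]
    | tmul y y' =>
      simp [h, Finset.sum_smul, smul_smul, mul_comm]

lemma alphaHom_apply_one (a : H) : alphaHom f a 1 = algebraMap k U (counit a) := by
  have : lam f a = (lam f a : ConvDual k U) := rfl
  simp [alphaHom_apply, rAct_apply, Algebra.TensorProduct.one_def, lam_apply, DualCop.toDual_one,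
    Algebra.algebraMap_eq_smul_one]

lemma betaHom_apply_one (a : H) : betaHom f a 1 = algebraMap k U (counit a) := by
  simp [betaHom_apply, lAct_apply, Algebra.TensorProduct.one_def, lamInv_apply,
    DualCop.toDual_one, Algebra.algebraMap_eq_smul_one]

lemma leftPart_mul_actU (v : U) :
    toConv ((LinearMap.mulRight k (actU v)) ∘ₗ (leftPart f).toLinearMap) =
    toConv (actU.toLinearMap ∘ₗ (alphaHom f).toLinearMap.flip v) *
      toConv (leftPart f).toLinearMap := by
  ext a w y
  let G : H ⊗[k] (H ⊗[k] H) →ₗ[k] U ⊗[k] H := TensorProduct.lift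
    (LinearMap.compl₁₂ (LinearMap.id : Module.End k (U ⊗[k] H) →ₗ[k] _)
      (actU.toLinearMap ∘ₗ (alphaHom f).toLinearMap.flip v)
      ((leftPartTwo f).toLinearMap.flip (w ⊗ₜ y)))
  have h₁ : ∀ s : H ⊗[k] H, leftPartTwo f s ((v * w) ⊗ₜ y) =
      G (TensorProduct.assoc k H H H ((comul (R := k)).rTensor H s)) := by
    intro s
    induction s with
    | zero => simp
    | add x y hx hy => simp only [map_add, LinearMap.add_apply, hx, hy]
    | tmul b c =>
      rw [leftPartTwo_tmul, TensorProduct.map_tmul, alphaHom_mul, LinearMap.rTensor_tmul]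
      generalize comul (R := k) b = t
      induction t with
      | zero => simp
      | add x y hx hy => simp only [map_add, add_tmul, hx, hy]
      | tmul b₁ b₂ => simp [G, leftPartTwo_tmul, actU_tmul]
  have h₂ : ∀ s : H ⊗[k] H, G ((comul (R := k)).lTensor H s) =
      LinearMap.mul' k _ (TensorProduct.map (actU.toLinearMap ∘ₗ (alphaHom f).toLinearMap.flip v)
        (leftPart f).toLinearMap s) (w ⊗ₜ y) := by
    intro s
    induction s with
    | zero => simp
    | add x y hx hy => simp only [map_add, LinearMap.add_apply, hx, hy]
    | tmul b c => simp [G, leftPart_apply]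
  have h₃ := h₁ (comul (R := k) a)
  rw [coassoc_apply, h₂] at h₃
  exact h₃

lemma rightPart_mul_actU (h : H) (v : U) : rightPart f h * actU v =
    LinearMap.mul' k _ (TensorProduct.map (actU.toLinearMap ∘ₗ (betaHom f).toLinearMap.flip v)
      (rightPart f).toLinearMap (TensorProduct.comm k H H (comul (R := k) h))) := by
  apply TensorProduct.ext'
  intro w y
  rw [Module.End.mul_apply, actU_tmul, rightPart_apply, LinearMap.rTensor_tmul, betaHom_mul]
  generalize TensorProduct.comm k H H (comul (R := k) h) = t
  induction t with
  | zero => simp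
  | add x y hx hy => simp only [map_add, add_tmul, LinearMap.add_apply, hx, hy]
  | tmul x y => simp [rightPart_apply, actU_tmul]

/-- `P_{b₁} Λ(v) Q_{b₂} = L(P_b(v ⊗ 1))`. -/
lemma leftPart_actU_rightPart (b : H) (v : U) :
    LinearMap.mul' k _ (TensorProduct.map
      (LinearMap.mulRight k (actU v) ∘ₗ (leftPart f).toLinearMap)
      (rightPart f).toLinearMap (comul (R := k) b)) = actD f (leftPart f b (v ⊗ₜ 1)) := by
  have h₁ : toConv (actU.toLinearMap ∘ₗ (alphaHom f).toLinearMap.flip v) *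
      toConv (actH f).toLinearMap = toConv (actU.toLinearMap ∘ₗ (alphaHom f).toLinearMap.flip v) *
        toConv (leftPart f).toLinearMap * toConv (rightPart f).toLinearMap := by
    rw [mul_assoc]
    congr 1
    ext a : 2
    exact actH_apply f a
  rw [← leftPart_mul_actU] at h₁
  refine congr(($(h₁.symm)).ofConv b).trans ?_
  rw [leftPart_apply]
  change LinearMap.mul' k _ (TensorProduct.map _ _ (comul (R := k) b)) = _
  generalize comul (R := k) b = t
  induction t with
  | zero => simp
  | add x y hx hy => simp only [map_add, LinearMap.add_apply, hx, hy]
  | tmul x y => simp [leftPartTwo_tmul, actD_tmul]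

lemma actH_mul_actU (a : H) (v : U) : actH f a * actU v = actD f (actH f a (v ⊗ₜ 1)) := by
  let J : H ⊗[k] (H ⊗[k] H) →ₗ[k] Module.End k (U ⊗[k] H) :=
    LinearMap.mul' k _ ∘ₗ TensorProduct.map (leftPart f).toLinearMap
      (LinearMap.mul' k _ ∘ₗ TensorProduct.map
        (actU.toLinearMap ∘ₗ (betaHom f).toLinearMap.flip v)
        (rightPart f).toLinearMap ∘ₗ (TensorProduct.comm k H H).toLinearMap)
  have h₁ : ∀ s : H ⊗[k] H, LinearMap.mul' k _ (TensorProduct.map (leftPart f).toLinearMap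
      (rightPart f).toLinearMap s) * actU v = J ((comul (R := k)).lTensor H s) := by
    intro s
    induction s with
    | zero => simp
    | add x y hx hy => simp only [map_add, add_mul, hx, hy]
    | tmul b c => simp [J, mul_assoc, rightPart_mul_actU]
  have h₂ : ∀ s : H ⊗[k] H, J (TensorProduct.assoc k H H H ((comul (R := k)).rTensor H s)) =
      actD f (LinearMap.mul' k _ (TensorProduct.map (leftPart f).toLinearMap
        (rightPart f).toLinearMap s) (v ⊗ₜ 1)) := by
    intro s
    induction s with
    | zero => simp
    | add x y hx hy => simp only [map_add, LinearMap.add_apply, hx, hy]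
    | tmul b c =>
      have := leftPart_actU_rightPart f b (betaHom f c v)
      simp only [TensorProduct.map_tmul, LinearMap.mul'_apply, AlgHom.toLinearMap_apply,
        Module.End.mul_apply, rightPart_apply, LinearMap.rTensor_tmul]
      rw [← this]
      generalize comul (R := k) b = t
      induction t with
      | zero => simp
      | add x y hx hy => simp only [map_add, add_tmul, hx, hy]
      | tmul b₁ b₂ => simp [J, mul_assoc]
  rw [actH_apply, h₁, ← coassoc_apply, h₂]

lemma leftPart_apply_one (a : H) : leftPart f a (1 ⊗ₜ 1) = 1 ⊗ₜ a := by
  have h : ∀ s : H ⊗[k] H, leftPartTwo f s (1 ⊗ₜ 1) =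
      1 ⊗ₜ TensorProduct.lid k H ((counit (R := k)).rTensor H s) := by
    intro s
    induction s with
    | zero => simp
    | add x y hx hy => simp only [map_add, LinearMap.add_apply, tmul_add, hx, hy]
    | tmul b c =>
      simp [leftPartTwo_tmul, alphaHom_apply_one, Algebra.algebraMap_eq_smul_one, smul_tmul]
  rw [leftPart_apply, h, rTensor_counit_comul]
  simp

lemma actH_apply_one (a : H) : actH f a (1 ⊗ₜ 1) = 1 ⊗ₜ a := by
  have h : ∀ s : H ⊗[k] H, LinearMap.mul' k _ (TensorProduct.map (leftPart f).toLinearMap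
      (rightPart f).toLinearMap s) (1 ⊗ₜ 1) =
      1 ⊗ₜ TensorProduct.rid k H ((counit (R := k)).lTensor H s) := by
    intro s
    induction s with
    | zero => simp
    | add x y hx hy => simp only [map_add, LinearMap.add_apply, tmul_add, hx, hy]
    | tmul b c =>
      simp [rightPart_apply, betaHom_apply_one, Algebra.algebraMap_eq_smul_one, 
        ← smul_tmul', leftPart_apply_one]
  rw [actH_apply, h, lTensor_counit_comul]
  simp

lemma actH_lTensor (a b : H) (t : U ⊗[k] H) : actH f a ((LinearMap.mulRight k b).lTensor U t) =
    (LinearMap.mulRight k b).lTensor U (actH f a t) := by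
  have hP : ∀ (a : H) (t : U ⊗[k] H), leftPart f a ((LinearMap.mulRight k b).lTensor U t) =
      (LinearMap.mulRight k b).lTensor U (leftPart f a t) := by
    intro a t
    rw [leftPart_apply]
    generalize comul (R := k) a = s
    induction s with
    | zero => simp
    | add x y hx hy => simp only [map_add, LinearMap.add_apply, hx, hy]
    | tmul c d =>
      induction t with
      | zero => simp
      | add x y hx hy => simp only [map_add, hx, hy]
      | tmul u h => simp [leftPartTwo_tmul, mul_assoc]
  have hQ : ∀ (a : H) (t : U ⊗[k] H), rightPart f a ((LinearMap.mulRight k b).lTensor U t) =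
      (LinearMap.mulRight k b).lTensor U (rightPart f a t) := by
    intro a t
    induction t with
    | zero => simp
    | add x y hx hy => simp only [map_add, hx, hy]
    | tmul u h => simp [rightPart_apply]
  rw [actH_apply]
  generalize comul (R := k) a = s
  induction s with
  | zero => simp
  | add x y hx hy => simp only [map_add, LinearMap.add_apply, hx, hy]
  | tmul c d => simp [hP, hQ]

/-- Associativity of the multiplication of the generalized double. -/
lemma actD_actD (x y : U ⊗[k] H) : actD f (actD f x y) = actD f x * actD f y := by
  have hU : ∀ (u : U) (y : U ⊗[k] H), actD f (actU u y) = actU u * actD f y := by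
    intro u y
    induction y with
    | zero => simp
    | add x y hx hy => simp only [map_add, mul_add, hx, hy]
    | tmul v b => simp [actU_tmul, actD_tmul, mul_assoc]
  have hR : ∀ (b : H) (t : U ⊗[k] H),
      actD f ((LinearMap.mulRight k b).lTensor U t) = actD f t * actH f b := by
    intro b t
    induction t with
    | zero => simp
    | add x y hx hy => simp only [map_add, add_mul, hx, hy]
    | tmul v b => simp [actD_tmul, mul_assoc]
  induction x with
  | zero => simp
  | add x y hx hy => simp only [map_add, LinearMap.add_apply, add_mul, hx, hy]
  | tmul u a =>
    induction y with
    | zero => simp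
    | add x y hx hy => simp only [map_add, mul_add, hx, hy]
    | tmul v b =>
      have h : (v ⊗ₜ[k] b : U ⊗[k] H) = (LinearMap.mulRight k b).lTensor U (v ⊗ₜ 1) := by simp
      rw [actD_tmul, Module.End.mul_apply, hU, h, actH_lTensor, hR, ← actH_mul_actU, hR]
      simp [actD_tmul, mul_assoc]

end Twist

/-- The generalized quantum double `D_f(U, H)`: the vector space `U ⊗ H` with the tensor product
coalgebra structure and the multiplication
`(u ⋈ a)(v ⋈ b) = λ(v₁, a₁) λ⁻¹(v₃, a₃) u v₂ ⋈ a₂ b`, where `λ(u, h) = f(u)(h)` and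
`λ⁻¹(u, h) = λ(S u, h)`. -/
def GenDouble {k U H : Type u} [Field k] [Ring U] [HopfAlgebra k U] [Ring H] [HopfAlgebra k H]
    [FiniteDimensional k H] (_f : U →ₐc[k] DualCop k H) : Type u := U ⊗[k] H

namespace GenDouble

variable {k U H : Type u} [Field k] [Ring U] [HopfAlgebra k U] [Ring H] [HopfAlgebra k H]
  [FiniteDimensional k H] (f : U →ₐc[k] DualCop k H)

instance : AddCommGroup (GenDouble f) := inferInstanceAs (AddCommGroup (U ⊗[k] H))
instance : Module k (GenDouble f) := inferInstanceAs (Module k (U ⊗[k] H))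
instance : Coalgebra k (GenDouble f) := inferInstanceAs (Coalgebra k (U ⊗[k] H))
instance [FiniteDimensional k U] : FiniteDimensional k (GenDouble f) :=
  inferInstanceAs (FiniteDimensional k (U ⊗[k] H))

/-- The element `u ⋈ a`. -/
def mk : U →ₗ[k] H →ₗ[k] GenDouble f := TensorProduct.mk k U H

variable {f} in
lemma induction {p : GenDouble f → Prop} (x : GenDouble f) (zero : p 0)
    (add : ∀ x y, p x → p y → p (x + y)) (mk : ∀ u a, p (mk f u a)) : p x :=
  TensorProduct.induction_on x zero mk add

/-- Left multiplication by `u ⋈ 1`. -/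
def leftU : U →ₐ[k] Module.End k (GenDouble f) := actU

/-- Left multiplication by `1 ⋈ a`. -/
def leftH : H →ₐ[k] Module.End k (GenDouble f) := actH f

lemma leftU_mk (u v : U) (a : H) : leftU f u (mk f v a) = mk f (u * v) a := rfl

lemma leftH_mk_one (a b : H) : leftH f a (mk f 1 b) = mk f 1 (a * b) := by
  have h := actH_lTensor f a b (1 ⊗ₜ 1)
  rw [actH_apply_one] at h
  simp only [LinearMap.lTensor_tmul, LinearMap.mulRight_apply, one_mul] at h
  exact h

/-- Left multiplication on the double, see `actD`. -/
def mulLin : GenDouble f →ₗ[k] Module.End k (GenDouble f) := actD f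

lemma mulLin_mulLin (x y : GenDouble f) :
    mulLin f (mulLin f x y) = mulLin f x * mulLin f y := actD_actD f x y

instance : Mul (GenDouble f) := ⟨fun x y => mulLin f x y⟩
instance : One (GenDouble f) := ⟨mk f 1 1⟩

lemma mul_def (x y : GenDouble f) : x * y = mulLin f x y := rfl
lemma one_def : (1 : GenDouble f) = mk f 1 1 := rfl

lemma mulLin_mk (u : U) (a : H) : mulLin f (mk f u a) = leftU f u * leftH f a := rfl

lemma mulLin_one : mulLin f 1 = 1 := by
  rw [one_def, mulLin_mk, map_one, map_one, mul_one]

lemma mulLin_apply_one (x : GenDouble f) : mulLin f x 1 = x := by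
  induction x using GenDouble.induction with
  | zero => simp
  | add x y hx hy => simp only [map_add, LinearMap.add_apply, hx, hy]
  | mk u a =>
    rw [mulLin_mk, one_def, Module.End.mul_apply, leftH_mk_one, leftU_mk, mul_one, mul_one]

instance : Ring (GenDouble f) where
  left_distrib x y z := by simp only [mul_def, map_add]
  right_distrib x y z := by simp only [mul_def, map_add, LinearMap.add_apply]
  zero_mul x := by simp [mul_def]
  mul_zero x := by simp [mul_def]
  mul_assoc x y z := by simp only [mul_def, mulLin_mulLin, Module.End.mul_apply]
  one_mul x := by simp [mul_def, mulLin_one]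
  mul_one x := by rw [mul_def, mulLin_apply_one]
  neg_add_cancel := neg_add_cancel
  zsmul := fun n x => n • x
  zsmul_zero' := SubNegMonoid.zsmul_zero'
  zsmul_succ' := SubNegMonoid.zsmul_succ'
  zsmul_neg' := SubNegMonoid.zsmul_neg'
  sub_eq_add_neg := sub_eq_add_neg
  nsmul := fun n x => n • x
  nsmul_zero := AddMonoid.nsmul_zero
  nsmul_succ := AddMonoid.nsmul_succ

instance : Algebra k (GenDouble f) :=
  Algebra.ofModule (fun r x y => by simp [mul_def]) (fun r x y => by simp [mul_def])

/-- The inclusion `u ↦ u ⋈ 1`. -/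
def ofU : U →ₐ[k] GenDouble f :=
  AlgHom.ofLinearMap ((mk f).flip 1) rfl (by
    intro u v
    simp only [LinearMap.flip_apply]
    rw [mul_def, mulLin_mk, map_one (leftH f), mul_one, leftU_mk])

/-- The inclusion `a ↦ 1 ⋈ a`. -/
def ofH : H →ₐ[k] GenDouble f :=
  AlgHom.ofLinearMap (mk f 1) rfl (by
    intro a b
    rw [mul_def, mulLin_mk, map_one (leftU f), one_mul, leftH_mk_one])

lemma ofU_apply (u : U) : ofU f u = mk f u 1 := rfl
lemma ofH_apply (a : H) : ofH f a = mk f 1 a := rfl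

lemma ofU_mul (u : U) (x : GenDouble f) : ofU f u * x = leftU f u x := by
  rw [mul_def, ofU_apply, mulLin_mk, map_one (leftH f), mul_one]

lemma ofH_mul (a : H) (x : GenDouble f) : ofH f a * x = leftH f a x := by
  rw [mul_def, ofH_apply, mulLin_mk, map_one (leftU f), one_mul]

lemma ofU_mul_ofH (u : U) (a : H) : ofU f u * ofH f a = mk f u a := by
  rw [ofU_mul, ofH_apply, leftU_mk, mul_one]

lemma counit_mk (u : U) (a : H) :
    counit (R := k) (mk f u a) = counit (R := k) u * counit (R := k) a := by
  refine (TensorProduct.counit_tmul (R := k) (S := k) u a).trans ?_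
  rw [smul_eq_mul, mul_comm]

/-- The Sweedler decomposition `Δ(u ⋈ a) = (u₁ ⋈ a₁) ⊗ (u₂ ⋈ a₂)`. -/
def reprMk {ι κ : Type*} {u : U} {a : H} (r : Coalgebra.Repr k u ι) (s : Coalgebra.Repr k a κ) :
    Coalgebra.Repr k (mk f u a) (ι × κ) where
  index := r.index ×ˢ s.index
  left i := mk f (r.left i.1) (s.left i.2)
  right i := mk f (r.right i.1) (s.right i.2)
  eq := (r.tmul s).eq

/-- The linear map `(u ⊗ u') ⊗ (a ⊗ a') ↦ (u ⋈ a) ⊗ (u' ⋈ a')`. -/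
def shuffle : (U ⊗[k] U) ⊗[k] (H ⊗[k] H) ≃ₗ[k] GenDouble f ⊗[k] GenDouble f :=
  TensorProduct.tensorTensorTensorComm k U U H H

lemma shuffle_tmul (u u' : U) (a a' : H) :
    shuffle f ((u ⊗ₜ u') ⊗ₜ (a ⊗ₜ a')) = mk f u a ⊗ₜ mk f u' a' := rfl

lemma comul_mk (u : U) (a : H) :
    comul (R := k) (mk f u a) = shuffle f (comul (R := k) u ⊗ₜ comul (R := k) a) := rfl

lemma comul_leftU (u : U) (x : GenDouble f) :
    comul (R := k) (leftU f u x) =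
      TensorProduct.map (ofU f).toLinearMap (ofU f).toLinearMap (comul (R := k) u) *
        comul (R := k) x := by
  induction x using GenDouble.induction with
  | zero => simp
  | add x y hx hy => simp only [map_add, mul_add, hx, hy]
  | mk v a =>
    rw [leftU_mk, comul_mk, comul_mk, Bialgebra.comul_mul]
    generalize comul (R := k) u = s
    generalize comul (R := k) v = t
    generalize comul (R := k) a = r
    induction s with
    | zero => simp
    | add x y hx hy => simp only [map_add, add_mul, add_tmul, hx, hy]
    | tmul s s' =>
      induction t with
      | zero => simp
      | add x y hx hy => simp only [map_add, mul_add, add_tmul, hx, hy]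
      | tmul t t' =>
        induction r with
        | zero => simp
        | add x y hx hy => simp only [map_add, mul_add, tmul_add, hx, hy]
        | tmul r r' => simp [shuffle_tmul, ofU_mul, leftU_mk]

/-- The operator `α_a ⊗ 1` on the double. -/
def opAlpha : H →ₗ[k] Module.End k (GenDouble f) :=
  LinearMap.rTensorHom (R := k) (N := U) (P := U) H ∘ₗ (alphaHom f).toLinearMap

lemma opAlpha_mk (h : H) (u : U) (a : H) :
    opAlpha f h (mk f u a) = mk f (alphaHom f h u) a := rfl

/-- The operator `1 ⊗ (left multiplication by a)` on the double. -/
def opMul : H →ₗ[k] Module.End k (GenDouble f) :=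
  LinearMap.lTensorHom (R := k) (N := H) (P := H) U ∘ₗ LinearMap.mul k H

lemma opMul_mk (h : H) (u : U) (a : H) : opMul f h (mk f u a) = mk f u (h * a) := rfl

/-- The operator `rightPart` on the double. -/
def opBeta : H →ₗ[k] Module.End k (GenDouble f) := (rightPart f).toLinearMap

lemma opBeta_mk (h : H) (u : U) (a : H) :
    opBeta f h (mk f u a) = mk f (betaHom f h u) a := rfl

/-- The operator `leftPartTwo` on the double. -/
def opLeftTwo : H ⊗[k] H →ₗ[k] Module.End k (GenDouble f) := (leftPartTwo f).toLinearMap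

/-- The operator `leftPart` on the double. -/
def opLeft : H →ₗ[k] Module.End k (GenDouble f) := (leftPart f).toLinearMap

lemma opLeft_conv : toConv (opLeft f) = toConv (opAlpha f) * toConv (opMul f) := by
  ext h x
  change opLeftTwo f (comul (R := k) h) x =
    LinearMap.mul' k _ (TensorProduct.map (opAlpha f) (opMul f) (comul (R := k) h)) x
  generalize comul (R := k) h = t
  induction t with
  | zero => simp
  | add t s ht hs => simp only [map_add, LinearMap.add_apply, ht, hs]
  | tmul b c =>
    induction x using GenDouble.induction with
    | zero => simp
    | add x y hx hy => simp only [map_add, hx, hy]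
    | mk u a => rfl

lemma leftH_conv : toConv (leftH f).toLinearMap = toConv (opLeft f) * toConv (opBeta f) := by
  ext h : 2
  exact actH_apply f h

/-- `T ↦ T ⊗ 1`. -/
def hat : Module.End k (GenDouble f) →ₐ[k] Module.End k (GenDouble f ⊗[k] GenDouble f) :=
  (Module.endTensorEndAlgHom (R := k) (S := k) (A := k)).comp
    Algebra.TensorProduct.includeLeft

/-- `T ↦ 1 ⊗ T`. -/
def chk : Module.End k (GenDouble f) →ₐ[k] Module.End k (GenDouble f ⊗[k] GenDouble f) :=
  (Module.endTensorEndAlgHom (R := k) (S := k) (A := k)).comp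
    Algebra.TensorProduct.includeRight

lemma hat_tmul (T : Module.End k (GenDouble f)) (x y : GenDouble f) :
    hat f T (x ⊗ₜ y) = T x ⊗ₜ y := rfl

lemma chk_tmul (T : Module.End k (GenDouble f)) (x y : GenDouble f) :
    chk f T (x ⊗ₜ y) = x ⊗ₜ T y := rfl

lemma hat_chk_commute (S T : Module.End k (GenDouble f)) : Commute (hat f S) (chk f T) := by
  apply TensorProduct.ext'
  intro x y
  rfl

/-- A family of operators on the first tensor factor. -/
def hatFam (X : H →ₗ[k] Module.End k (GenDouble f)) :
    WithConv (H →ₗ[k] Module.End k (GenDouble f ⊗[k] GenDouble f)) :=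
  toConv ((hat f).toLinearMap ∘ₗ X)

/-- A family of operators on the second tensor factor. -/
def chkFam (X : H →ₗ[k] Module.End k (GenDouble f)) :
    WithConv (H →ₗ[k] Module.End k (GenDouble f ⊗[k] GenDouble f)) :=
  toConv ((chk f).toLinearMap ∘ₗ X)

lemma hatFam_mul (X Y : H →ₗ[k] Module.End k (GenDouble f)) :
    hatFam f (toConv X * toConv Y).ofConv = hatFam f X * hatFam f Y :=
  WithConv.ext (LinearMap.algHom_comp_convMul_distrib (hat f) (toConv X) (toConv Y))

lemma chkFam_mul (X Y : H →ₗ[k] Module.End k (GenDouble f)) :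
    chkFam f (toConv X * toConv Y).ofConv = chkFam f X * chkFam f Y :=
  WithConv.ext (LinearMap.algHom_comp_convMul_distrib (chk f) (toConv X) (toConv Y))

lemma rel_mul {X Y : H →ₗ[k] Module.End k (GenDouble f)}
    {X' Y' : WithConv (H →ₗ[k] Module.End k (GenDouble f ⊗[k] GenDouble f))}
    (hX : ∀ a x, comul (R := k) (X a x) = X'.ofConv a (comul (R := k) x))
    (hY : ∀ a x, comul (R := k) (Y a x) = Y'.ofConv a (comul (R := k) x)) (a : H)
    (x : GenDouble f) :
    comul (R := k) ((toConv X * toConv Y).ofConv a x) = (X' * Y').ofConv a (comul (R := k) x) := by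
  rw [(ℛ k a).convMul_apply, (ℛ k a).convMul_apply]
  simp [LinearMap.sum_apply, hX, hY]

lemma comul_opAlpha (a : H) (x : GenDouble f) :
    comul (R := k) (opAlpha f a x) = (hatFam f (opAlpha f)).ofConv a (comul (R := k) x) := by
  change _ = hat f (opAlpha f a) (comul (R := k) x)
  induction x using GenDouble.induction with
  | zero => simp
  | add x y hx hy => simp only [map_add, hx, hy]
  | mk u b =>
    rw [opAlpha_mk, comul_mk, comul_mk, alphaHom_apply, comul_rAct]
    generalize comul (R := k) u = s
    generalize comul (R := k) b = t
    induction s with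
    | zero => simp
    | add x y hx hy => simp only [map_add, add_tmul, hx, hy]
    | tmul u v =>
      induction t with
      | zero => simp
      | add x y hx hy => simp only [map_add, tmul_add, hx, hy]
      | tmul b c => rfl

lemma comul_opBeta (a : H) (x : GenDouble f) :
    comul (R := k) (opBeta f a x) = (chkFam f (opBeta f)).ofConv a (comul (R := k) x) := by
  change _ = chk f (opBeta f a) (comul (R := k) x)
  induction x using GenDouble.induction with
  | zero => simp
  | add x y hx hy => simp only [map_add, hx, hy]
  | mk u b =>
    rw [opBeta_mk, comul_mk, comul_mk, betaHom_apply, comul_lAct]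
    generalize comul (R := k) u = s
    generalize comul (R := k) b = t
    induction s with
    | zero => simp
    | add x y hx hy => simp only [map_add, add_tmul, hx, hy]
    | tmul u v =>
      induction t with
      | zero => simp
      | add x y hx hy => simp only [map_add, tmul_add, hx, hy]
      | tmul b c => rfl

lemma comul_opMul (a : H) (x : GenDouble f) : comul (R := k) (opMul f a x) =
    (hatFam f (opMul f) * chkFam f (opMul f)).ofConv a (comul (R := k) x) := by
  change _ = LinearMap.mul' k _ (TensorProduct.map ((hat f).toLinearMap ∘ₗ opMul f)
    ((chk f).toLinearMap ∘ₗ opMul f) (comul (R := k) a)) (comul (R := k) x)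
  induction x using GenDouble.induction with
  | zero => simp
  | add x y hx hy => simp only [map_add, hx, hy]
  | mk u b =>
    rw [opMul_mk, comul_mk, comul_mk, Bialgebra.comul_mul]
    generalize comul (R := k) u = s
    generalize comul (R := k) b = t
    generalize comul (R := k) a = r
    induction s with
    | zero => simp
    | add x y hx hy => simp only [map_add, add_tmul, hx, hy]
    | tmul u v =>
      induction t with
      | zero => simp
      | add x y hx hy => simp only [map_add, mul_add, tmul_add, hx, hy]
      | tmul b c =>
        induction r with
        | zero => simp
        | add x y hx hy =>
          simp only [map_add, add_mul, tmul_add, LinearMap.add_apply, hx, hy]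
        | tmul d e =>
          rw [Algebra.TensorProduct.tmul_mul_tmul]
          rfl

/-- The operator `rAct φ ⊗ 1` on the double. -/
def opR : ConvDual k U →ₗ[k] Module.End k (GenDouble f) :=
  LinearMap.rTensorHom (R := k) (N := U) (P := U) H ∘ₗ rAct

lemma opR_mul (φ ψ : ConvDual k U) : opR f (φ * ψ) = opR f ψ * opR f φ := by
  ext x
  induction x using GenDouble.induction with
  | zero => simp
  | add x y hx hy => simp only [map_add, hx, hy]
  | mk u a => exact congrArg (fun T : Module.End k U => mk f (T u) a) (rAct_mul φ ψ)

lemma opR_one : opR f 1 = 1 := by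
  ext x
  induction x using GenDouble.induction with
  | zero => simp
  | add x y hx hy => simp only [map_add, hx, hy]
  | mk u a => exact congrArg (fun T : Module.End k U => mk f (T u) a) rAct_one

lemma hatBeta_comul (b : H) (x : GenDouble f) :
    hat f (opBeta f b) (comul (R := k) x) = chk f (opR f (lamInv f b)) (comul (R := k) x) := by
  induction x using GenDouble.induction with
  | zero => simp
  | add x y hx hy => simp only [map_add, hx, hy]
  | mk u a =>
    have h₁ : ∀ (s : U ⊗[k] U) (t : H ⊗[k] H), hat f (opBeta f b) (shuffle f (s ⊗ₜ t)) =
        shuffle f ((lAct (lamInv f b)).rTensor U s ⊗ₜ t) := by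
      intro s t
      induction s with
      | zero => simp
      | add x y hx hy => simp only [map_add, add_tmul, hx, hy]
      | tmul u v =>
        induction t with
        | zero => simp
        | add x y hx hy => simp only [map_add, tmul_add, hx, hy]
        | tmul b c => rfl
    have h₂ : ∀ (s : U ⊗[k] U) (t : H ⊗[k] H), chk f (opR f (lamInv f b)) (shuffle f (s ⊗ₜ t)) =
        shuffle f ((rAct (lamInv f b)).lTensor U s ⊗ₜ t) := by
      intro s t
      induction s with
      | zero => simp
      | add x y hx hy => simp only [map_add, add_tmul, hx, hy]
      | tmul u v =>
        induction t with
        | zero => simp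
        | add x y hx hy => simp only [map_add, tmul_add, hx, hy]
        | tmul b c => rfl
    rw [comul_mk, h₁, h₂, lAct_rTensor_comul]

lemma hatBeta_chkAlpha (b c : H) (x : GenDouble f) :
    hat f (opBeta f b) (chk f (opAlpha f c) (comul (R := k) x)) =
      chk f (opR f (lamInv f b * lam f c)) (comul (R := k) x) := by
  have h := congrArg (fun T => T (comul (R := k) x))
    (hat_chk_commute f (opBeta f b) (opAlpha f c))
  simp only [Module.End.mul_apply] at h
  rw [h, hatBeta_comul, opR_mul, map_mul]
  rfl

lemma hatBeta_mul_chkAlpha (a : H) (x : GenDouble f) :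
    (hatFam f (opBeta f) * chkFam f (opAlpha f)).ofConv a (comul (R := k) x) =
      counit (R := k) a • comul (R := k) x := by
  rw [(ℛ k a).convMul_apply, LinearMap.sum_apply]
  refine (Finset.sum_congr rfl fun i _ => hatBeta_chkAlpha f _ _ x).trans ?_
  rw [← LinearMap.sum_apply, ← map_sum, ← map_sum, lamInv_mul_lam,
    Algebra.algebraMap_eq_smul_one, map_smul, map_smul, opR_one, map_one]
  rfl

lemma hatBeta_chkAlpha_chkMul (a : H) (x : GenDouble f) :
    (hatFam f (opBeta f) * chkFam f (opAlpha f) * chkFam f (opMul f)).ofConv a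
      (comul (R := k) x) = (chkFam f (opMul f)).ofConv a (comul (R := k) x) := by
  have hc : ∀ b c, Commute ((hatFam f (opBeta f) * chkFam f (opAlpha f)).ofConv b)
      ((chkFam f (opMul f)).ofConv c) := by
    intro b c
    rw [(ℛ k b).convMul_apply]
    refine Commute.sum_left _ _ _ fun i _ => Commute.mul_left (hat_chk_commute f _ _) ?_
    have : Commute (opAlpha f ((ℛ k b).right i)) (opMul f c) := by
      ext y
      induction y using GenDouble.induction with
      | zero => simp
      | add x y hx hy => simp only [map_add, hx, hy]
      | mk u a => rfl
    exact this.map (chk f)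
  rw [(ℛ k a).convMul_apply, LinearMap.sum_apply]
  have h : ∀ i, ((hatFam f (opBeta f) * chkFam f (opAlpha f)).ofConv ((ℛ k a).left i) *
      (chkFam f (opMul f)).ofConv ((ℛ k a).right i)) (comul (R := k) x) =
      (chkFam f (opMul f)).ofConv (counit (R := k) ((ℛ k a).left i) • (ℛ k a).right i)
        (comul (R := k) x) := by
    intro i
    rw [(hc _ _).eq, Module.End.mul_apply, hatBeta_mul_chkAlpha, map_smul, map_smul]
    rfl
  refine (Finset.sum_congr rfl fun i _ => h i).trans ?_
  rw [← LinearMap.sum_apply, ← map_sum, sum_counit_smul]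

lemma comul_leftH (a : H) (x : GenDouble f) :
    comul (R := k) (leftH f a x) =
      (hatFam f (leftH f).toLinearMap * chkFam f (leftH f).toLinearMap).ofConv a
        (comul (R := k) x) := by
  have hL : ∀ a x, comul (R := k) (opLeft f a x) =
      (hatFam f (opLeft f) * chkFam f (opMul f)).ofConv a (comul (R := k) x) := by
    intro a x
    have h := rel_mul f (comul_opAlpha f) (comul_opMul f) a x
    rw [← opLeft_conv, ← mul_assoc, ← hatFam_mul, ← opLeft_conv] at h
    exact h
  have h₁ := rel_mul f hL (comul_opBeta f) a x
  rw [← leftH_conv] at h₁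
  refine h₁.trans ?_
  have e₁ : hatFam f (leftH f).toLinearMap = hatFam f (opLeft f) * hatFam f (opBeta f) := by
    rw [← hatFam_mul, ← leftH_conv]
  have e₂ : chkFam f (leftH f).toLinearMap =
      chkFam f (opAlpha f) * chkFam f (opMul f) * chkFam f (opBeta f) := by
    rw [← chkFam_mul, ← opLeft_conv, ← chkFam_mul, ← leftH_conv]
  have e₃ : hatFam f (leftH f).toLinearMap * chkFam f (leftH f).toLinearMap =
      hatFam f (opLeft f) * ((hatFam f (opBeta f) * chkFam f (opAlpha f) * chkFam f (opMul f)) *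
        chkFam f (opBeta f)) := by
    rw [e₁, e₂]
    simp only [mul_assoc]
  rw [e₃, mul_assoc]
  have key : ∀ b, (chkFam f (opMul f) * chkFam f (opBeta f)).ofConv b (comul (R := k) x) =
      ((hatFam f (opBeta f) * chkFam f (opAlpha f) * chkFam f (opMul f)) *
        chkFam f (opBeta f)).ofConv b (comul (R := k) x) := by
    intro b
    rw [(ℛ k b).convMul_apply, (ℛ k b).convMul_apply, LinearMap.sum_apply, LinearMap.sum_apply]
    refine Finset.sum_congr rfl fun i _ => ?_
    rw [Module.End.mul_apply, Module.End.mul_apply, ← comul_opBeta, hatBeta_chkAlpha_chkMul]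
  rw [(ℛ k a).convMul_apply, (ℛ k a).convMul_apply, LinearMap.sum_apply, LinearMap.sum_apply]
  refine Finset.sum_congr rfl fun i _ => ?_
  rw [Module.End.mul_apply, Module.End.mul_apply, key]

lemma comul_mul_aux (x y : GenDouble f) :
    comul (R := k) (x * y) = comul (R := k) x * comul (R := k) y := by
  have hH : ∀ (a : H) (z : GenDouble f ⊗[k] GenDouble f),
      (hatFam f (leftH f).toLinearMap * chkFam f (leftH f).toLinearMap).ofConv a z =
        TensorProduct.map (ofH f).toLinearMap (ofH f).toLinearMap (comul (R := k) a) * z := by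
    intro a z
    change LinearMap.mul' k _ (TensorProduct.map ((hat f).toLinearMap ∘ₗ (leftH f).toLinearMap)
      ((chk f).toLinearMap ∘ₗ (leftH f).toLinearMap) (comul (R := k) a)) z = _
    generalize comul (R := k) a = s
    induction s with
    | zero => simp
    | add x y hx hy => simp only [map_add, add_mul, LinearMap.add_apply, hx, hy]
    | tmul b c =>
      induction z with
      | zero => simp
      | add x y hx hy => simp only [map_add, mul_add, hx, hy]
      | tmul x y => simp [hat_tmul, chk_tmul, ofH_mul]
  induction x using GenDouble.induction with
  | zero => simp
  | add x y hx hy => simp only [map_add, add_mul, hx, hy]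
  | mk u a =>
    have h : comul (R := k) (mk f u a) =
        TensorProduct.map (ofU f).toLinearMap (ofU f).toLinearMap (comul (R := k) u) *
        TensorProduct.map (ofH f).toLinearMap (ofH f).toLinearMap (comul (R := k) a) := by
      rw [comul_mk]
      generalize comul (R := k) u = s
      generalize comul (R := k) a = t
      induction s with
      | zero => simp
      | add x y hx hy => simp only [map_add, add_mul, add_tmul, hx, hy]
      | tmul u v =>
        induction t with
        | zero => simp
        | add x y hx hy => simp only [map_add, mul_add, tmul_add, hx, hy]
        | tmul b c => simp [shuffle_tmul, ofU_mul_ofH]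
    rw [h, mul_assoc, ← hH, ← comul_leftH, ← comul_leftU, ← ofU_mul, ← ofH_mul, ← mul_assoc,
      ofU_mul_ofH]

lemma counit_opLeft (a : H) (v : U) (b : H) :
    counit (R := k) (opLeft f a (mk f v b)) = (lam f a).ofConv v * counit (R := k) b := by
  have hr : ∀ φ : ConvDual k U, counit (R := k) (rAct φ v) = φ.ofConv v := by
    intro φ
    have h := convDual_mul_apply_rAct φ 1 v
    rw [mul_one] at h
    exact h.symm
  have h : ∀ s : H ⊗[k] H, counit (R := k) (opLeftTwo f s (mk f v b)) =
      (lam f (TensorProduct.rid k H ((counit (R := k)).lTensor H s))).ofConv v *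
        counit (R := k) b := by
    intro s
    induction s with
    | zero => simp
    | add x y hx hy => simp only [map_add, ofConv_add, add_mul, LinearMap.add_apply, hx, hy]
    | tmul c d =>
      refine (counit_mk f (alphaHom f c v) (d * b)).trans ?_
      rw [alphaHom_apply, hr]
      simp
      ring
  refine (h (comul (R := k) a)).trans ?_
  rw [lTensor_counit_comul]
  simp

lemma counit_leftH (a : H) (x : GenDouble f) :
    counit (R := k) (leftH f a x) = counit (R := k) a * counit (R := k) x := by
  induction x using GenDouble.induction with
  | zero => simp
  | add x y hx hy => simp only [map_add, mul_add, hx, hy]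
  | mk v b =>
    have h₁ : leftH f a (mk f v b) = ∑ i ∈ (ℛ k a).index,
        opLeft f ((ℛ k a).left i) (opBeta f ((ℛ k a).right i) (mk f v b)) := by
      have h := congrArg (fun T => T (mk f v b))
        ((ℛ k a).convMul_apply (toConv (opLeft f)) (toConv (opBeta f)))
      rw [← leftH_conv] at h
      simpa [LinearMap.sum_apply] using h
    have h₂ : ∀ i, counit (R := k) (opLeft f ((ℛ k a).left i)
        (opBeta f ((ℛ k a).right i) (mk f v b))) =
        (lam f ((ℛ k a).left i) * lamInv f ((ℛ k a).right i)).ofConv v *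
          counit (R := k) b := by
      intro i
      rw [opBeta_mk, counit_opLeft, convDual_mul_apply_lAct]
      rfl
    rw [h₁, map_sum, Finset.sum_congr rfl fun i _ => h₂ i, ← Finset.sum_mul,
      ← LinearMap.sum_apply, ← ofConv_sum, lam_mul_lamInv, counit_mk, ← mul_assoc,
      Algebra.algebraMap_eq_smul_one]
    rfl

lemma counit_mul_aux (x y : GenDouble f) :
    counit (R := k) (x * y) = counit (R := k) x * counit (R := k) y := by
  induction x using GenDouble.induction with
  | zero => simp
  | add x y hx hy => simp only [map_add, add_mul, hx, hy]
  | mk u a =>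
    rw [← ofU_mul_ofH, mul_assoc, ofH_mul, ofU_mul]
    have hU : ∀ z : GenDouble f, counit (R := k) (leftU f u z) =
        counit (R := k) u * counit (R := k) z := by
      intro z
      induction z using GenDouble.induction with
      | zero => simp
      | add x y hx hy => simp only [map_add, mul_add, hx, hy]
      | mk v b => simp [leftU_mk, counit_mk, mul_assoc]
    rw [hU, counit_leftH, ofU_mul_ofH, counit_mk, mul_assoc]

instance : Bialgebra k (GenDouble f) :=
  Bialgebra.mk' k (GenDouble f)
    (by rw [one_def, counit_mk]; simp)
    (counit_mul_aux f _ _)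
    (by
      rw [one_def, comul_mk, Bialgebra.comul_one, Bialgebra.comul_one]
      rfl)
    (comul_mul_aux f _ _)

/-- The antipode `S(u ⋈ a) = S(a) S(u)`. -/
def antipodeLin : GenDouble f →ₗ[k] GenDouble f :=
  TensorProduct.lift ((LinearMap.mul k (GenDouble f)).flip.compl₁₂
    ((ofU f).toLinearMap ∘ₗ antipode k) ((ofH f).toLinearMap ∘ₗ antipode k))

lemma antipodeLin_mk (u : U) (a : H) : antipodeLin f (mk f u a) =
    ofH f (antipode k a) * ofU f (antipode k u) := rfl

instance : HopfAlgebra k (GenDouble f) :=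
  HopfAlgebra.ofConvInverse (antipodeLin f)
    (by
      ext x
      induction x using GenDouble.induction with
      | zero => simp
      | add x y hx hy => simp only [map_add, hx, hy]
      | mk u a =>
        refine ((reprMk f (ℛ k u) (ℛ k a)).convMul_apply _ _).trans ?_
        have h : ∀ i j, antipodeLin f (mk f ((ℛ k u).left i) ((ℛ k a).left j)) *
            mk f ((ℛ k u).right i) ((ℛ k a).right j) =
            ofH f (antipode k ((ℛ k a).left j)) *
              (ofU f (antipode k ((ℛ k u).left i) * (ℛ k u).right i) *
                ofH f ((ℛ k a).right j)) := by
          intro i j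
          rw [antipodeLin_mk, ← ofU_mul_ofH, map_mul]
          simp only [mul_assoc]
        refine (Finset.sum_product_right _ _ _).trans ?_
        refine (Finset.sum_congr rfl fun j _ => Finset.sum_congr rfl fun i _ => h i j).trans ?_
        simp only [← Finset.mul_sum, ← Finset.sum_mul, ← map_sum,
          sum_antipode_mul_eq_algebraMap_counit, AlgHom.commutes]
        simp only [← mul_assoc, ← Algebra.commutes]
        simp only [mul_assoc, ← map_mul, ← Finset.mul_sum, ← map_sum,
          sum_antipode_mul_eq_algebraMap_counit, AlgHom.commutes]
        rw [← counit_mk f]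
        rfl)
    (by
      ext x
      induction x using GenDouble.induction with
      | zero => simp
      | add x y hx hy => simp only [map_add, hx, hy]
      | mk u a =>
        refine ((reprMk f (ℛ k u) (ℛ k a)).convMul_apply _ _).trans ?_
        have h : ∀ i j, mk f ((ℛ k u).left i) ((ℛ k a).left j) *
            antipodeLin f (mk f ((ℛ k u).right i) ((ℛ k a).right j)) =
            ofU f ((ℛ k u).left i) * (ofH f ((ℛ k a).left j * antipode k ((ℛ k a).right j)) *
              ofU f (antipode k ((ℛ k u).right i))) := by
          intro i j
          rw [antipodeLin_mk, ← ofU_mul_ofH, map_mul]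
          simp only [mul_assoc]
        refine (Finset.sum_product _ _ _).trans ?_
        refine (Finset.sum_congr rfl fun i _ => Finset.sum_congr rfl fun j _ => h i j).trans ?_
        simp only [← Finset.mul_sum, ← Finset.sum_mul, ← map_sum,
          sum_mul_antipode_eq_algebraMap_counit, AlgHom.commutes]
        simp only [← mul_assoc, ← Algebra.commutes]
        simp only [mul_assoc, ← map_mul, ← Finset.mul_sum, ← map_sum,
          sum_mul_antipode_eq_algebraMap_counit, AlgHom.commutes]
        rw [mul_comm, ← counit_mk f]
        rfl)

end GenDouble

section HopfNotions

variable {k A : Type u} [Field k] [Ring A]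

/-- A Hopf subalgebra: a subalgebra `K` with `Δ(K) ⊆ K ⊗ K` which, as a bialgebra, has an
antipode. When the ambient bialgebra is a Hopf algebra this says that `K` is stable under the
antipode, see `isHopfSubalgebra_iff`. -/
structure IsHopfSubalgebra [Bialgebra k A] (K : Subalgebra k A) : Prop where
  comul_mem : ∀ a ∈ K, comul (R := k) a ∈
    LinearMap.range (TensorProduct.map K.toSubmodule.subtype K.toSubmodule.subtype)
  exists_antipode : ∃ S : A →ₗ[k] A, ∀ a ∈ K, S a ∈ K ∧
    LinearMap.mul' k A (S.rTensor A (comul (R := k) a)) = algebraMap k A (counit a) ∧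
    LinearMap.mul' k A (S.lTensor A (comul (R := k) a)) = algebraMap k A (counit a)

lemma isHopfSubalgebra_iff [HopfAlgebra k A] (K : Subalgebra k A) : IsHopfSubalgebra K ↔
    (∀ a ∈ K, comul (R := k) a ∈
      LinearMap.range (TensorProduct.map K.toSubmodule.subtype K.toSubmodule.subtype)) ∧
    ∀ a ∈ K, antipode k a ∈ K := by
  constructor
  · rintro ⟨hc, S, hS⟩
    refine ⟨hc, fun a ha => ?_⟩
    have key : ∀ t : A ⊗[k] A, LinearMap.mul' k A (TensorProduct.map S
          (LinearMap.mul' k A ∘ₗ (antipode k).lTensor A)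
            ((comul (R := k)).lTensor A t)) =
          S (TensorProduct.rid k A ((counit (R := k)).lTensor A t)) := by
      intro t
      induction t with
      | zero => simp
      | add x y hx hy => simp only [map_add, hx, hy]
      | tmul x y =>
        simp [Algebra.algebraMap_eq_smul_one]
    have key₂ : ∀ t : A ⊗[k] A, t ∈ LinearMap.range
        (TensorProduct.map K.toSubmodule.subtype K.toSubmodule.subtype) →
        LinearMap.mul' k A (TensorProduct.map S
          (LinearMap.mul' k A ∘ₗ (antipode k).lTensor A)
            (TensorProduct.assoc k A A A ((comul (R := k)).rTensor A t))) =
          antipode k (TensorProduct.lid k A ((counit (R := k)).rTensor A t)) := by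
      rintro _ ⟨t, rfl⟩
      induction t with
      | zero => simp
      | add x y hx hy => simp only [map_add, hx, hy]
      | tmul x y =>
        have h := (hS x x.2).2.1
        simp only [TensorProduct.map_tmul, LinearMap.rTensor_tmul, Submodule.subtype_apply,
          lid_tmul, map_smul]
        have h' : ∀ s : A ⊗[k] A, LinearMap.mul' k A (TensorProduct.map S
            (LinearMap.mul' k A ∘ₗ (antipode k).lTensor A)
              (TensorProduct.assoc k A A A (s ⊗ₜ[k] (y : A)))) =
            LinearMap.mul' k A (S.rTensor A s) * antipode k (y : A) := by
          intro s
          induction s with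
          | zero => simp
          | add x y hx hy => simp only [map_add, add_tmul, add_mul, hx, hy]
          | tmul p q => simp [mul_assoc]
        rw [h', h, Algebra.algebraMap_eq_smul_one, smul_mul_assoc, one_mul]
    have h₁ := key (comul (R := k) a)
    have h₂ := key₂ _ (hc a ha)
    rw [coassoc_apply, h₁, lTensor_counit_comul, rTensor_counit_comul] at h₂
    simp only [rid_tmul, lid_tmul, one_smul] at h₂
    rw [← h₂]
    exact (hS a ha).1
  · rintro ⟨hc, hS⟩
    exact ⟨hc, antipode k, fun a ha => ⟨hS a ha, mul_antipode_rTensor_comul_apply a,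
      mul_antipode_lTensor_comul_apply a⟩⟩

/-- `K` is the largest central Hopf subalgebra of `A`. -/
def IsHopfCentre [Bialgebra k A] (K : Subalgebra k A) : Prop :=
  IsGreatest {K : Subalgebra k A | IsHopfSubalgebra K ∧ K ≤ Subalgebra.center k A} K

/-- `e` is an injective Hopf algebra map from the dual group algebra `kG^*` (the functions on `G`
with pointwise product, `Δ(p_g) = ∑_{xy = g} p_x ⊗ p_y` and `ε(φ) = φ(1)`, where `p_g` is the
indicator function of `g`) to `A`. -/
structure IsDualGroupEmbedding [Bialgebra k A] {G : Type*} [Group G] [Fintype G] [DecidableEq G]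
    (e : (G → k) →ₐ[k] A) : Prop where
  injective : Function.Injective e
  comul_single : ∀ g : G, comul (R := k) (e (Pi.single g 1)) =
    ∑ x : G, e (Pi.single x 1) ⊗ₜ[k] e (Pi.single (x⁻¹ * g) 1)
  counit_apply : ∀ φ : G → k, counit (R := k) (e φ) = φ 1

variable [HopfAlgebra k A]

/-- The left adjoint action `a ↦ a₁ b S(a₂)` on `b`. -/
def leftAdj (b : A) : A →ₗ[k] A :=
  LinearMap.mul' k A ∘ₗ TensorProduct.map (LinearMap.mulRight k b) (antipode k) ∘ₗ comul

/-- The right adjoint action `a ↦ S(a₁) b a₂` on `b`. -/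
def rightAdj : A →ₗ[k] A →ₗ[k] A :=
  LinearMap.mk₂ k (fun b a => LinearMap.mul' k A (TensorProduct.map (antipode k)
    (LinearMap.mulLeft k b) (comul (R := k) a)))
    (by
      intro b c a
      have : LinearMap.mulLeft k (b + c) = LinearMap.mulLeft k b + LinearMap.mulLeft k c := by
        ext x; simp [add_mul]
      rw [this, TensorProduct.map_add_right, LinearMap.add_apply, map_add])
    (by
      intro c b a
      have : LinearMap.mulLeft k (c • b) = c • LinearMap.mulLeft k b := by
        ext x; simp
      rw [this, TensorProduct.map_smul_right, LinearMap.smul_apply, map_smul])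
    (by intro b a a'; simp only [map_add])
    (by intro c b a; simp only [map_smul])

/-- `B` is a normal Hopf subalgebra of `A`: it is stable under both adjoint actions of `A`. -/
structure IsNormalHopfSubalgebra (B : Subalgebra k A) : Prop where
  isHopfSubalgebra : IsHopfSubalgebra B
  leftAdj_mem : ∀ b ∈ B, ∀ a, leftAdj (k := k) b a ∈ B
  rightAdj_mem : ∀ b ∈ B, ∀ a, rightAdj (k := k) b a ∈ B

end HopfNotions

section Conjugate

variable {k A : Type u} [Field k] [Ring A] [HopfAlgebra k A] [FiniteDimensional k A]

section Comodule

variable (W : Type u) [AddCommGroup W] [Module k W] [Module (ConvDual k A) W]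
  [IsScalarTower k (ConvDual k A) W]

variable (k A) in
/-- The right `A`-comodule structure `w ↦ w₀ ⊗ w₁` of an `A^*`-module `W`, which is determined by
`φ • w = φ(w₁) w₀`; in terms of a basis `a_i` of `A` it is `w ↦ ∑ (a_i^* • w) ⊗ a_i`. -/
def coaction : W →ₗ[k] W ⊗[k] A :=
  ∑ i, (TensorProduct.mk k W A).flip (Module.finBasis k A i) ∘ₗ
    Algebra.lsmul k k W (toConv ((Module.finBasis k A).coord i) : ConvDual k A)

variable (k A) in
/-- The coefficient coalgebra `C_W` of an `A^*`-module `W`: the span of all `ξ(w₀) w₁`, for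
`w` in `W` and `ξ` a linear functional on `W`. For irreducible `W` this is the simple
subcoalgebra of `A` associated to `W`. -/
def coeffSpace : Submodule k A :=
  Submodule.span k {a | ∃ (ξ : W →ₗ[k] k) (w : W),
    a = TensorProduct.lid k A (ξ.rTensor A (coaction k A W w))}

lemma coaction_spec (φ : ConvDual k A) (w : W) :
    TensorProduct.rid k W (φ.ofConv.lTensor W (coaction k A W w)) = φ • w := by
  conv_rhs => rw [show φ = ∑ i, φ.ofConv (Module.finBasis k A i) •
    (toConv ((Module.finBasis k A).coord i) : ConvDual k A) by
      apply WithConv.ext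
      refine (Module.finBasis k A).ext fun j => ?_
      simp]
  simp [coaction, LinearMap.sum_apply, Finset.sum_smul]

variable {B : Subalgebra k A} (hB : IsNormalHopfSubalgebra B)
  {M : Type u} [AddCommGroup M] [Module k M] (σ : B →ₐ[k] Module.End k M)

/-- The map `b ⊗ a ↦ S(a₁) b a₂` with values in the normal Hopf subalgebra `B`. -/
def adjOn : B →ₗ[k] A →ₗ[k] B :=
  LinearMap.mk₂ k (fun b a => ⟨rightAdj (b : A) a, hB.rightAdj_mem b b.2 a⟩)
    (by intro b c a; ext; simp)
    (by intro r b a; ext; simp)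
    (by intro b a c; ext; simp)
    (by intro r b a; ext; simp)

/-- The conjugate `B`-module `W ⊗ M` of a `B`-module `M` by an `A^*`-module `W`:
`b (w ⊗ m) = w₀ ⊗ (S(w₁) b w₂) m`. -/
def conjAction : B →ₗ[k] Module.End k (W ⊗[k] M) where
  toFun b := (TensorProduct.lift (σ.toLinearMap ∘ₗ adjOn hB b)).lTensor W ∘ₗ
    (TensorProduct.assoc k W A M).toLinearMap ∘ₗ (coaction k A W).rTensor M
  map_add' b c := by
    rw [← LinearMap.add_comp, ← LinearMap.lTensor_add]
    congr 2
    apply TensorProduct.ext'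
    intro a m
    simp
  map_smul' r b := by
    rw [RingHom.id_apply, ← LinearMap.smul_comp, ← LinearMap.lTensor_smul]
    congr 2
    apply TensorProduct.ext'
    intro a m
    simp

/-- `W` stabilizes the `B`-module `M` with character `α`: the character of the conjugate module
`W ⊗ M` is `(dim W) α`. -/
def Stabilizes : Prop :=
  ∀ b : B, LinearMap.trace k (W ⊗[k] M) (conjAction W hB σ b) =
    (Module.finrank k W : k) * LinearMap.trace k M (σ b)

/-- The conjugate module `W ⊗ M` is isomorphic to the direct sum of `dim W` copies of `N`. -/
def ConjugateIsMultipleOf {N : Type u} [AddCommGroup N] [Module k N]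
    (τ : B →ₐ[k] Module.End k N) : Prop :=
  ∃ e : W ⊗[k] M ≃ₗ[k] (Fin (Module.finrank k W) → N),
    ∀ b t i, e (conjAction W hB σ b t) i = τ b (e t i)

end Comodule

variable {B : Subalgebra k A} (hB : IsNormalHopfSubalgebra B)
  {M : Type u} [AddCommGroup M] [Module k M] (σ : B →ₐ[k] Module.End k M)

/-- The irreducible `B`-module `N` is a conjugate of the `B`-module `M` in `A`: it is a constituent
of the conjugate module `W ⊗ M` for some irreducible `A^*`-module `W`. -/
def IsConjugate {N : Type u} [AddCommGroup N] [Module k N] (τ : B →ₐ[k] Module.End k N) : Prop :=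
  ∃ (W : Type u) (_ : AddCommGroup W) (_ : Module k W) (_ : Module (ConvDual k A) W)
    (_ : IsScalarTower k (ConvDual k A) W), IsSimpleModule (ConvDual k A) W ∧
    ∃ j : N →ₗ[k] W ⊗[k] M, Function.Injective j ∧ ∀ b n, j (τ b n) = conjAction W hB σ b (j n)

/-- The stabilizer of the `B`-module `M` in `A`: the sum of the coefficient coalgebras `C_W` of
the finite dimensional `A^*`-modules `W` that stabilize `M`. -/
def stabilizer : Submodule k A :=
  sSup {C | ∃ (W : Type u) (_ : AddCommGroup W) (_ : Module k W) (_ : Module (ConvDual k A) W)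
    (_ : IsScalarTower k (ConvDual k A) W) (_ : FiniteDimensional k W),
    Stabilizes W hB σ ∧ C = coeffSpace k A W}

end Conjugate

/-- The one dimensional module `k p_g` of `kG^*` over the image of an injective algebra map
`e : kG^* → A`: the element `e φ` acts by `φ(g)`. -/
def groupRep {k : Type u} {A : Type*} [Field k] [Ring A] [Algebra k A] {G : Type*}
    (e : (G → k) →ₐ[k] A) (he : Function.Injective e) (g : G) : e.range →ₐ[k] Module.End k k :=
  (Algebra.lmul k k).comp
    ((Pi.evalAlgHom k (fun _ : G => k) g).comp (AlgEquiv.ofInjective e he).symm.toAlgHom)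

lemma groupRep_apply {k : Type u} {A : Type*} [Field k] [Ring A] [Algebra k A] {G : Type*}
    (e : (G → k) →ₐ[k] A) (he : Function.Injective e) (g : G) (φ : G → k) (c : k) :
    groupRep e he g ⟨e φ, φ, rfl⟩ c = φ g * c := by
  have h : (AlgEquiv.ofInjective e he).symm ⟨e φ, φ, rfl⟩ = φ := by
    rw [AlgEquiv.symm_apply_eq]
    rfl
  exact congrArg (fun ψ : G → k => ψ g * c) h

namespace GenDouble

variable {k U H : Type u} [Field k] [Ring U] [HopfAlgebra k U] [Ring H] [HopfAlgebra k H]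
  [FiniteDimensional k H] (f : U →ₐc[k] DualCop k H)

lemma ofU_injective : Function.Injective (ofU f) := by
  have h : Function.LeftInverse
      (fun x : GenDouble f => TensorProduct.rid k U ((counit (R := k) (A := H)).lTensor U x))
      (ofU f) := by
    intro u
    have h : ofU f u = mk f u 1 := by
      simpa using ofU_mul_ofH f u 1
    rw [h]
    change TensorProduct.rid k U ((counit (R := k) (A := H)).lTensor U (u ⊗ₜ 1)) = u
    simp
  exact h.injective

/-- The subspace `U ⋈ L` of `D_f(U, H)`, for `L` contained in `H`. -/
def bowtie (L : Subalgebra k H) : Submodule k (GenDouble f) :=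
  Submodule.span k {x | ∃ u : U, ∃ l ∈ L, x = mk f u l}

/-- The embedding of `kG^*` in `D_f(U, H)` given by an embedding in `U`. -/
def ofGroup {G : Type*} (e : (G → k) →ₐ[k] U) : (G → k) →ₐ[k] GenDouble f := (ofU f).comp e

lemma ofGroup_injective {G : Type*} {e : (G → k) →ₐ[k] U} (he : Function.Injective e) :
    Function.Injective (ofGroup f e) :=
  (ofU_injective f).comp he

end GenDouble

section Components

variable {k H : Type u} [Field k] [Ring H] [Bialgebra k H]
  (V : Type u) [AddCommGroup V] [Module k V] [Module (DualCop k H) V]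

/-- The `H^*`-module `V` belongs to `Rep(L^*)`, for `L` contained in `H`: the action of `H^*`
factors through the restriction map `H^* → L^*`. -/
def InRepDual (L : Subalgebra k H) : Prop :=
  ∀ α : DualCop k H, (∀ l ∈ L, DualCop.toDual α l = 0) → ∀ v : V, α • v = 0

variable {F : Type*} (e : (F → k) →ₐ[k] DualCop k H)

/-- The submodule `W` of the `H^{* cop}`-module `V` belongs to the grading component of
`x`: its restriction to `kF^*` is a direct sum of copies of `k q_x`. -/
def InComponent {V} [AddCommGroup V] [Module k V] [Module (DualCop k H) V] (x : F)
    (W : Submodule (DualCop k H) V) : Prop :=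
  ∀ v ∈ W, ∀ ψ : F → k, e ψ • v = ψ x • v

/-- The `H^{* cop}`-module `V` belongs to the sum of the grading components of the `x ∈ X`. -/
def InSumOfComponents (X : Set F) : Prop :=
  ∃ W : X → Submodule (DualCop k H) V, iSupIndep W ∧ ⨆ x, W x = ⊤ ∧ ∀ x, InComponent e x.1 (W x)

end Components

/-- `L` is a Hopf subalgebra of `H` such that `Rep(L^*)` is the sum of the grading components
of `Rep(H^{* cop})` of the `x ∈ X`. -/
def IsSubalgebraOfComponents {k H : Type u} [Field k] [Ring H] [HopfAlgebra k H]
    {F : Type*} (e : (F → k) →ₐ[k] DualCop k H) (X : Set F) (L : Subalgebra k H) : Prop :=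
  IsHopfSubalgebra L ∧
    ∀ (V : Type u) [AddCommGroup V] [Module k V] [Module (DualCop k H) V]
      [IsScalarTower k (DualCop k H) V] [FiniteDimensional k V],
      InRepDual V L ↔ InSumOfComponents V e X

end

/-!
The subalgebra `kF^* = K(H^{* cop})` is central in `H^*` and closed under the comultiplication of
`H^{* cop}`. Its indicator functions `q_x` are therefore orthogonal central idempotents of `H^*`,
and they decompose `H` into a direct sum of subcoalgebras `H_x`, with `H_y H_x ⊆ H_{x y}`
(`CocentralGrading`). The functionals `ε ⊗ q_x` decompose `A = D_f(U, H)` in the same way, with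
components `U ⊗ H_x` (`GenDouble.cocentralGrading_extend`): the two skew pairings in the product
`(u ⋈ a)(v ⋈ b)` cancel as soon as the `v`-component is reduced by `ε`, because `q_x` is central.

Since `f` is surjective, it maps the largest central Hopf subalgebra `kG^*` of `U` into `kF^*`
(`IsHopfCentre.map_le`). The only subtle point is the antipode of the image, which exists because
`H^{* cop}` is finite dimensional. A morphism `kG^* → kF^*` of Hopf algebras is dual to a group
morphism `f^* : F → G` (`IsDualGroupEmbedding.exists_monoidHom`).

The heart of the matter is `GenDouble.ofH_mul_ofGroup`: for `a ∈ H_y`, `x = f^*(y)` and `g ∈ G`,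
one has `a p_g = p_{x⁻¹ g x} a` in `A`. As `kG^*` is central in `U`, both adjoint actions of
`U ⊗ H_y` on `kG^*` are thus given by conjugation with `x`, up to the counit. So `kG^*` is normal,
and on `W ⊗ k p_g` a function `φ` on `G` acts as the sum over `y` of `φ(f^*(y)⁻¹ g f^*(y))` times
the action of `ε ⊗ q_y` on `W` (`GenDouble.conjAction_ofGroup`).

An irreducible `A^*`-module lies in a single degree `y`, and every degree occurs, which gives the
conjugates. An arbitrary `W` stabilizes `g` if and only if it lives in the degrees `y` for which
`f^*(y)` centralizes `g`, by comparing the traces of `p_g` in characteristic zero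
(`GenDouble.stabilizes_iff`); equivalently `C_W` is contained in the part of `A` in these degrees.
This part is `U ⋈ L(g)`, where `L(g)` is the corresponding part of `H`. Both are Hopf subalgebras
because these `y` form a subgroup of `F` (`CocentralGrading.isHopfSubalgebra_part`). Finally, `L(g)`
is determined by `Rep(L(g)^*)`, since the cyclic module `H^* / L^⊥` recovers `L^⊥`.
-/

noncomputable section

/-! ### Cocentral gradings -/

/-- Central orthogonal idempotents `q x` of the dual algebra `X^*`, indexed by a group `F` and with
sum `1`, such that `q x (b a) = ∑ q s (a) q t (b)` over `s t = x`. They decompose `X` as a direct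
sum of subcoalgebras `X_x`, with `X_t X_s ⊆ X_{s t}`. Equivalently, `p_x ↦ q x` is a central
morphism of Hopf algebras from `kF^*` to `X^{* cop}`. -/
structure CocentralGrading {k X : Type u} {F : Type*} [Field k] [Ring X] [Bialgebra k X]
    [Group F] [Fintype F] [DecidableEq F] (q : F → ConvDual k X) : Prop where
  mul_eq : ∀ x y, q x * q y = if x = y then q x else 0
  sum_eq : ∑ x, q x = 1
  comm : ∀ x φ, q x * φ = φ * q x
  apply_mul : ∀ x a b, (q x).ofConv (b * a) = ∑ s, (q s).ofConv a * (q (s⁻¹ * x)).ofConv b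
  apply_one : ∀ x, (q x).ofConv 1 = if x = 1 then 1 else 0

section Coalgebra

variable {k X : Type u} [Field k] [Ring X] [Bialgebra k X]

lemma convDual_ext_apply {a b : X} (h : ∀ φ : ConvDual k X, φ.ofConv a = φ.ofConv b) :
    a = b := by
  rw [← sub_eq_zero, ← Module.forall_dual_apply_eq_zero_iff k (a - b)]
  intro φ
  have := h (toConv φ)
  simpa [sub_eq_zero] using this

/-- The two actions of a central functional agree: `φ(a₁) a₂ = a₁ φ(a₂)`. -/
lemma rAct_eq_lAct {φ : ConvDual k X} (h : ∀ ψ, φ * ψ = ψ * φ) : rAct φ = lAct φ := by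
  ext a
  refine convDual_ext_apply (k := k) fun ψ => ?_
  rw [← convDual_mul_apply_rAct, ← convDual_mul_apply_lAct, h]

lemma lAct_repr {ι : Type*} (φ : ConvDual k X) {a : X} (r : Coalgebra.Repr k a ι) :
    lAct φ a = ∑ i ∈ r.index, φ.ofConv (r.right i) • r.left i := by
  rw [lAct_apply, ← r.eq]
  simp

lemma rAct_repr {ι : Type*} (φ : ConvDual k X) {a : X} (r : Coalgebra.Repr k a ι) :
    rAct φ a = ∑ i ∈ r.index, φ.ofConv (r.left i) • r.right i := by
  rw [rAct_apply, ← r.eq]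
  simp

lemma counit_lAct (φ : ConvDual k X) (a : X) : counit (R := k) (lAct φ a) = φ.ofConv a := by
  have h := convDual_mul_apply_lAct 1 φ a
  rw [one_mul] at h
  exact h.symm

end Coalgebra

namespace CocentralGrading

variable {k X : Type u} {F : Type*} [Field k] [Ring X] [Bialgebra k X] [Group F] [Fintype F]
  [DecidableEq F]
  {q : F → ConvDual k X} (hq : CocentralGrading q)
include hq

lemma lAct_lAct (x y : F) (a : X) :
    lAct (q x) (lAct (q y) a) = if x = y then lAct (q x) a else 0 := by
  rw [← Module.End.mul_apply, ← lAct_mul, hq.mul_eq]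
  split_ifs <;> simp

lemma sum_lAct (a : X) : ∑ x, lAct (q x) a = a := by
  rw [← LinearMap.sum_apply, ← map_sum, hq.sum_eq, lAct_one]
  rfl

lemma rAct_eq (x : F) : rAct (q x) = lAct (q x) := rAct_eq_lAct (hq.comm x)

lemma comul_lAct_left (x : F) (a : X) :
    comul (R := k) (lAct (q x) a) = (lAct (q x)).rTensor X (comul (R := k) a) := by
  rw [← hq.rAct_eq, comul_rAct]

lemma lAct_mul_apply (x : F) (b a : X) :
    lAct (q x) (b * a) = ∑ s, lAct (q (s⁻¹ * x)) b * lAct (q s) a := by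
  simp only [lAct_apply, Bialgebra.comul_mul]
  generalize comul (R := k) b = t
  generalize comul (R := k) a = r
  induction t with
  | zero => simp
  | add y z hy hz => simp only [add_mul, map_add, Finset.sum_add_distrib, hy, hz]
  | tmul b₁ b₂ =>
    induction r with
    | zero => simp
    | add y z hy hz => simp only [mul_add, map_add, Finset.sum_add_distrib, hy, hz]
    | tmul a₁ a₂ => simp [hq.apply_mul, Finset.sum_smul, smul_smul]

lemma lAct_apply_one (x : F) : lAct (q x) 1 = if x = 1 then 1 else 0 := by
  rw [lAct_apply, Bialgebra.comul_one, Algebra.TensorProduct.one_def]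
  simp [hq.apply_one]

lemma sum_apply (a : X) : ∑ x, (q x).ofConv a = counit (R := k) a := by
  rw [← LinearMap.sum_apply, ← ofConv_sum, hq.sum_eq]
  rfl

lemma lAct_mul_lAct (x z : F) (c d : X) :
    lAct (q x) (c * lAct (q z) d) = lAct (q (z⁻¹ * x)) c * lAct (q z) d := by
  rw [hq.lAct_mul_apply, Finset.sum_eq_single z]
  · rw [hq.lAct_lAct, if_pos rfl]
  · intro s _ hs
    rw [hq.lAct_lAct, if_neg hs, mul_zero]
  · simp

lemma lAct_lAct_mul (x z : F) (c d : X) :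
    lAct (q x) (lAct (q z) c * d) = lAct (q z) c * lAct (q (x * z⁻¹)) d := by
  rw [hq.lAct_mul_apply, Finset.sum_eq_single (x * z⁻¹)]
  · rw [hq.lAct_lAct, if_pos (by group)]
    congr 3
    group
  · intro s _ hs
    rw [hq.lAct_lAct, if_neg, zero_mul]
    rintro rfl
    exact hs (by group)
  · simp

omit hq in
variable (q) in
/-- The sum of the homogeneous components `X_x` with `x ∈ N`: the elements whose components of
degree outside `N` vanish. -/
def part (N : Set F) : Submodule k X where
  carrier := {a | ∀ y ∉ N, lAct (q y) a = 0}
  add_mem' ha hb y hy := by rw [map_add, ha y hy, hb y hy, add_zero]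
  zero_mem' y _ := map_zero _
  smul_mem' c a ha y hy := by rw [map_smul, ha y hy, smul_zero]

lemma lAct_mem_part {N : Set F} {x : F} (hx : x ∈ N) (a : X) : lAct (q x) a ∈ part q N := by
  intro y hy
  rw [hq.lAct_lAct, if_neg]
  rintro rfl
  exact hy hx

omit hq in
omit [Group F] [DecidableEq F] in
variable (q) in
open Classical in
/-- The idempotent of `X^*` that cuts out the components of degree in `N`. -/
def idem (N : Set F) : ConvDual k X := ∑ x with x ∈ N, q x

lemma mul_idem (N : Set F) (y : F) [Decidable (y ∈ N)] :
    q y * idem q N = if y ∈ N then q y else 0 := by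
  classical
  simp [idem, Finset.mul_sum, hq.mul_eq]

lemma idem_comm (N : Set F) (φ : ConvDual k X) : idem q N * φ = φ * idem q N := by
  simp only [idem, Finset.mul_sum, Finset.sum_mul, hq.comm]

lemma idem_mul_idem (N : Set F) : idem q N * idem q N = idem q N := by
  classical
  conv_lhs => rw [idem, Finset.sum_mul]
  conv_rhs => rw [idem]
  refine Finset.sum_congr rfl fun x hx => ?_
  change q x * idem q N = _
  rw [hq.mul_idem, if_pos (by simpa using hx)]

lemma lAct_idem {N : Set F} {a : X} (ha : a ∈ part q N) : lAct (idem q N) a = a := by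
  classical
  conv_rhs => rw [← hq.sum_lAct a]
  rw [idem, map_sum, LinearMap.sum_apply, Finset.sum_filter]
  refine Finset.sum_congr rfl fun x _ => ?_
  split_ifs with hx
  · rfl
  · rw [ha x hx]

lemma lAct_idem_mem (N : Set F) (a : X) : lAct (idem q N) a ∈ part q N := by
  rw [idem, map_sum, LinearMap.sum_apply]
  exact Submodule.sum_mem _ fun x hx => hq.lAct_mem_part (by simpa using hx) a

lemma apply_mul_idem {N : Set F} {a : X} (ha : a ∈ part q N) (φ : ConvDual k X) :
    (φ * idem q N).ofConv a = φ.ofConv a := by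
  rw [convDual_mul_apply_lAct, hq.lAct_idem ha]

lemma comul_mem_part {N : Set F} {a : X} (ha : a ∈ part q N) : comul (R := k) a ∈
    LinearMap.range (TensorProduct.map (part q N).subtype (part q N).subtype) := by
  have h₁ : (lAct (idem q N)).lTensor X (comul (R := k) a) = comul (R := k) a := by
    rw [← comul_lAct, hq.lAct_idem ha]
  have h₂ : (lAct (idem q N)).rTensor X (comul (R := k) a) = comul (R := k) a := by
    rw [← rAct_eq_lAct (hq.idem_comm N), ← comul_rAct, rAct_eq_lAct (hq.idem_comm N),
      hq.lAct_idem ha]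
  rw [← h₁, ← h₂]
  generalize comul (R := k) a = t
  induction t with
  | zero => simp
  | add x y hx hy => simp only [map_add]; exact Submodule.add_mem _ hx hy
  | tmul x y =>
    exact ⟨⟨_, hq.lAct_idem_mem N x⟩ ⊗ₜ ⟨_, hq.lAct_idem_mem N y⟩, rfl⟩

/-- The sum of the homogeneous components of degree in a subgroup `N` of `F`, as a subalgebra. -/
def partSubalgebra (N : Subgroup F) : Subalgebra k X where
  carrier := part q (N : Set F)
  add_mem' := (part q (N : Set F)).add_mem
  mul_mem' := by
    intro b a hb ha y hy
    rw [hq.lAct_mul_apply]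
    refine Finset.sum_eq_zero fun s _ => ?_
    by_cases hs : s ∈ N
    · rw [hb, zero_mul]
      intro h
      exact hy (by simpa using N.mul_mem hs h)
    · rw [ha s hs, mul_zero]
  algebraMap_mem' := by
    intro c y hy
    rw [Algebra.algebraMap_eq_smul_one, map_smul, hq.lAct_apply_one, if_neg, smul_zero]
    rintro rfl
    exact hy N.one_mem

end CocentralGrading

namespace CocentralGrading

variable {k X : Type u} {F : Type*} [Field k] [Ring X] [HopfAlgebra k X] [Group F] [Fintype F]
  [DecidableEq F] {q : F → ConvDual k X} (hq : CocentralGrading q)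
include hq

/-- For `a` homogeneous of degree `z`, the component of degree `z⁻¹` of `S(a₁)` already satisfies
the antipode identity against `a₂`. -/
lemma antipode_left (z : F) (a : X) :
    LinearMap.mul' k X ((lAct (q z⁻¹) ∘ₗ antipode k ∘ₗ lAct (q z)).rTensor X
      (comul (R := k) a)) = algebraMap k X ((q z).ofConv a) := by
  have key : ∀ t : X ⊗[k] X, LinearMap.mul' k X ((lAct (q z⁻¹) ∘ₗ antipode k).rTensor X
      ((lAct (q z)).lTensor X t)) =
      lAct (q 1) (LinearMap.mul' k X ((antipode k).rTensor X ((lAct (q z)).lTensor X t))) := by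
    intro t
    induction t with
    | zero => simp
    | add x y hx hy => simp only [map_add, hx, hy]
    | tmul x y => simp [hq.lAct_mul_lAct]
  have h := key (comul (R := k) (lAct (q z) a))
  rw [← comul_lAct, hq.lAct_lAct, if_pos rfl, mul_antipode_rTensor_comul_apply,
    Algebra.algebraMap_eq_smul_one, map_smul, hq.lAct_apply_one, if_pos rfl, counit_lAct,
    hq.comul_lAct_left, ← LinearMap.rTensor_comp_apply, LinearMap.comp_assoc] at h
  rw [h, Algebra.algebraMap_eq_smul_one]

lemma antipode_right (z : F) (a : X) :
    LinearMap.mul' k X ((lAct (q z⁻¹) ∘ₗ antipode k ∘ₗ lAct (q z)).lTensor X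
      (comul (R := k) a)) = algebraMap k X ((q z).ofConv a) := by
  have key : ∀ t : X ⊗[k] X, LinearMap.mul' k X ((lAct (q z⁻¹) ∘ₗ antipode k).lTensor X
      ((lAct (q z)).rTensor X t)) =
      lAct (q 1) (LinearMap.mul' k X ((antipode k).lTensor X ((lAct (q z)).rTensor X t))) := by
    intro t
    induction t with
    | zero => simp
    | add x y hx hy => simp only [map_add, hx, hy]
    | tmul x y => simp [hq.lAct_lAct_mul]
  have h := key (comul (R := k) (lAct (q z) a))
  rw [← hq.comul_lAct_left, hq.lAct_lAct, if_pos rfl, mul_antipode_lTensor_comul_apply,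
    Algebra.algebraMap_eq_smul_one, map_smul, hq.lAct_apply_one, if_pos rfl, counit_lAct,
    comul_lAct, ← LinearMap.lTensor_comp_apply, LinearMap.comp_assoc] at h
  rw [h, Algebra.algebraMap_eq_smul_one]

lemma isHopfSubalgebra_part (N : Subgroup F) : IsHopfSubalgebra (hq.partSubalgebra N) where
  comul_mem _ ha := hq.comul_mem_part ha
  exists_antipode := by
    -- only the component of degree `z⁻¹` of `S` on `X_z` is kept; it lies in the part over `N` by
    -- construction, and no formula for `Δ ∘ S` is needed
    refine ⟨∑ z, lAct (q z⁻¹) ∘ₗ antipode k ∘ₗ lAct (q z), fun a ha => ⟨?_, ?_, ?_⟩⟩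
    · rw [LinearMap.sum_apply]
      refine Subalgebra.sum_mem _ fun z _ => ?_
      by_cases hz : z ∈ N
      · exact hq.lAct_mem_part (N.inv_mem hz) _
      · rw [LinearMap.comp_apply, LinearMap.comp_apply, ha z hz, map_zero, map_zero]
        exact Subalgebra.zero_mem _
    · refine (congrArg (fun T => LinearMap.mul' k X (T (comul (R := k) a)))
        (map_sum (LinearMap.rTensorHom X) _ _)).trans ?_
      rw [LinearMap.sum_apply, map_sum]
      simp only [LinearMap.coe_rTensorHom, hq.antipode_left]
      rw [← map_sum, hq.sum_apply]
    · refine (congrArg (fun T => LinearMap.mul' k X (T (comul (R := k) a)))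
        (map_sum (LinearMap.lTensorHom X) _ _)).trans ?_
      rw [LinearMap.sum_apply, map_sum]
      simp only [LinearMap.coe_lTensorHom, hq.antipode_right]
      rw [← map_sum, hq.sum_apply]

end CocentralGrading

/-! ### Functions on a finite set -/

section Functions

variable {k R F : Type*} [Field k] [Ring R] [Algebra k R] [Fintype F] [DecidableEq F]
  (e : (F → k) →ₐ[k] R)

lemma map_eq_sum_single {M : Type*} [AddCommGroup M] [Module k M] (l : (F → k) →ₗ[k] M)
    (ψ : F → k) : l ψ = ∑ x, ψ x • l (Pi.single x 1) := by
  conv_lhs => rw [← Finset.univ_sum_single ψ]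
  rw [map_sum]
  refine Finset.sum_congr rfl fun x _ => ?_
  rw [← map_smul, ← Pi.single_smul, smul_eq_mul, mul_one]

lemma algHom_eq_sum_single (ψ : F → k) : e ψ = ∑ x, ψ x • e (Pi.single x 1) :=
  map_eq_sum_single e.toLinearMap ψ

lemma sum_algHom_single : ∑ x, e (Pi.single x 1) = 1 := by
  have h := algHom_eq_sum_single e 1
  simp only [map_one, Pi.one_apply, one_smul] at h
  exact h.symm

omit [Fintype F] in
lemma algHom_single_mul_algHom_single (x y : F) : e (Pi.single x 1) * e (Pi.single y 1) =
    if x = y then e (Pi.single x 1) else 0 := by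
  rw [← map_mul]
  split_ifs with h
  · rw [h, ← Pi.single_mul, one_mul]
  · rw [← map_zero e]
    congr 1
    ext z
    by_cases hz : z = x
    · subst hz; simp [h]
    · simp [hz]

end Functions

/-! ### The grading of `H` by a central dual group algebra in `H^{* cop}` -/

/-- The indicator function of `x`, embedded in `H^{* cop}` by `e`, as a functional on `H`. -/
def degreeFunctional {k H : Type u} {F : Type*} [Field k] [Ring H] [Bialgebra k H] [DecidableEq F]
    (e : (F → k) →ₐ[k] DualCop k H) (x : F) : ConvDual k H :=
  e (Pi.single x 1)

section Components

variable {k H : Type u} {F : Type*} [Field k] [Ring H] [HopfAlgebra k H] [FiniteDimensional k H]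
  [Group F] [Fintype F] [DecidableEq F] {e : (F → k) →ₐ[k] DualCop k H}

lemma cocentralGrading_degreeFunctional (he : IsDualGroupEmbedding e)
    (hc : e.range ≤ Subalgebra.center k (DualCop k H)) :
    CocentralGrading (degreeFunctional e) where
  mul_eq := algHom_single_mul_algHom_single e
  sum_eq := sum_algHom_single e
  comm x φ := ((Subalgebra.mem_center_iff (R := k)).1 (hc ⟨Pi.single x 1, rfl⟩)
    (show DualCop k H from φ)).symm
  apply_mul x a b := by
    have h := DualCop.pair_comul (e (Pi.single x 1)) a b
    rw [he.comul_single, map_sum, LinearMap.sum_apply] at h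
    exact h.symm
  apply_one x := by
    refine (he.counit_apply (Pi.single x 1)).trans ?_
    rw [Pi.single_apply]
    simp [eq_comm]

omit [FiniteDimensional k H] [Group F] in
/-- A module belongs to the sum of the components of the `x ∈ X` if and only if the idempotents of
the other components annihilate it. -/
lemma inSumOfComponents_iff (hc : e.range ≤ Subalgebra.center k (DualCop k H)) (X : Set F)
    {V : Type u} [AddCommGroup V] [Module k V] [Module (DualCop k H) V]
    [IsScalarTower k (DualCop k H) V] :
    InSumOfComponents V e X ↔ ∀ y ∉ X, ∀ v : V, e (Pi.single y 1) • v = 0 := by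
  constructor
  · rintro ⟨W, -, hW, hcomp⟩ y hy v
    have hv : v ∈ ⨆ x, W x := hW ▸ Submodule.mem_top
    induction hv using Submodule.iSup_induction' with
    | mem x w hw =>
      rw [hcomp x w hw, Pi.single_eq_of_ne, zero_smul]
      rintro h
      exact hy (h ▸ x.2)
    | zero => simp
    | add v w _ _ hv hw => rw [smul_add, hv, hw, add_zero]
  · intro h
    let W : X → Submodule (DualCop k H) V := fun x =>
      { carrier := {v | e (Pi.single x.1 1) • v = v}
        add_mem' := fun {v w} hv hw => by
          rw [Set.mem_ofPred_eq] at *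
          rw [smul_add, hv, hw]
        zero_mem' := smul_zero _
        smul_mem' := fun α v hv => by
          rw [Set.mem_ofPred_eq] at *
          have hα := (Subalgebra.mem_center_iff (R := k)).1 (hc ⟨Pi.single x.1 1, rfl⟩) α
          rw [← mul_smul]
          change (e (Pi.single x.1 1) * α) • v = _
          rw [show e (Pi.single x.1 1) * α = α * e (Pi.single x.1 1) from hα.symm, mul_smul, hv] }
    have hkill : ∀ (x y : F), x ≠ y → ∀ v : V, e (Pi.single x 1) • e (Pi.single y 1) • v = 0 := by
      intro x y hxy v
      rw [← mul_smul, algHom_single_mul_algHom_single, if_neg hxy, zero_smul]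
    refine ⟨W, ?_, ?_, ?_⟩
    · intro x
      rw [Submodule.disjoint_def]
      intro v hv hv'
      rw [← show e (Pi.single x.1 1) • v = v from hv]
      clear hv
      induction hv' using Submodule.iSup_induction' with
      | mem y w hw =>
        by_cases hxy : y = x
        · simp [hxy] at hw
          rw [hw, smul_zero]
        · simp only [ne_eq, hxy, not_false_eq_true, iSup_pos] at hw
          rw [← show e (Pi.single y.1 1) • w = w from hw]
          exact hkill _ _ (fun h => hxy (Subtype.ext h.symm)) w
      | zero => simp
      | add v w _ _ hv hw => rw [smul_add, hv, hw, add_zero]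
    · rw [eq_top_iff]
      intro v _
      have hsum : v = ∑ x, e (Pi.single x 1) • v := by
        rw [← Finset.sum_smul, sum_algHom_single, one_smul]
      rw [hsum]
      refine Submodule.sum_mem _ fun x _ => ?_
      by_cases hx : x ∈ X
      · refine Submodule.mem_iSup_of_mem (⟨x, hx⟩ : X) ?_
        change e (Pi.single x 1) • e (Pi.single x 1) • v = e (Pi.single x 1) • v
        rw [← mul_smul, algHom_single_mul_algHom_single, if_pos rfl]
      · rw [h x hx]
        exact Submodule.zero_mem _
    · intro x v hv ψ
      have hv' : e (Pi.single x.1 1) • v = v := hv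
      rw [← hv', ← mul_smul, algHom_eq_sum_single e ψ, Finset.sum_mul]
      simp [algHom_single_mul_algHom_single]

variable (he : IsDualGroupEmbedding e) (hc : e.range ≤ Subalgebra.center k (DualCop k H))

lemma inRepDual_part_iff (N : Subgroup F)
    {V : Type u} [AddCommGroup V] [Module k V] [Module (DualCop k H) V]
    [IsScalarTower k (DualCop k H) V] :
    InRepDual V ((cocentralGrading_degreeFunctional he hc).partSubalgebra N) ↔
      ∀ y ∉ N, ∀ v : V, e (Pi.single y 1) • v = 0 := by
  have hq := cocentralGrading_degreeFunctional he hc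
  constructor
  · intro h y hy v
    refine h _ (fun l hl => ?_) v
    change (degreeFunctional e y).ofConv l = 0
    rw [← counit_lAct, hl y hy, map_zero]
  · intro h α hα v
    have hv : v = ∑ x, e (Pi.single x 1) • v := by
      rw [← Finset.sum_smul, sum_algHom_single, one_smul]
    rw [hv, Finset.smul_sum]
    refine Finset.sum_eq_zero fun x _ => ?_
    by_cases hx : x ∈ N
    · rw [← mul_smul]
      have : α * e (Pi.single x 1) = 0 := by
        apply DualCop.toDual.injective
        ext a
        refine (convDual_mul_apply_lAct (show ConvDual k H from α) (degreeFunctional e x) a).trans ?_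
        exact hα _ (hq.lAct_mem_part hx a)
      rw [this, zero_smul]
    · rw [h x hx, smul_zero]

lemma isSubalgebraOfComponents_part (N : Subgroup F) :
    IsSubalgebraOfComponents e (N : Set F)
      ((cocentralGrading_degreeFunctional he hc).partSubalgebra N) :=
  ⟨CocentralGrading.isHopfSubalgebra_part _ N, fun V _ _ _ _ _ => by
    rw [inRepDual_part_iff he hc, inSumOfComponents_iff hc]
    rfl⟩

end Components

instance DualCop.finiteDimensional {k H : Type u} [Field k] [Ring H] [Bialgebra k H]
    [FiniteDimensional k H] : FiniteDimensional k (DualCop k H) :=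
  Module.Finite.equiv (DualCop.toDual (k := k) (H := H)).symm

section Uniqueness

variable {k H : Type u} [Field k] [Ring H] [HopfAlgebra k H] [FiniteDimensional k H]

/-- The left ideal of the functionals vanishing on a Hopf subalgebra. -/
def annihilatorIdeal {L : Subalgebra k H} (hL : IsHopfSubalgebra L) :
    Submodule (DualCop k H) (DualCop k H) where
  carrier := {α | ∀ l ∈ L, DualCop.toDual α l = 0}
  add_mem' ha hb l hl := by rw [map_add, LinearMap.add_apply, ha l hl, hb l hl, add_zero]
  zero_mem' l _ := by simp
  smul_mem' β α hα l hl := by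
    rw [smul_eq_mul, DualCop.toDual_mul]
    obtain ⟨t, ht⟩ := hL.comul_mem l hl
    rw [← ht]
    clear ht
    induction t with
    | zero => simp
    | add x y hx hy => simp only [map_add, hx, hy, add_zero]
    | tmul x y => simp [hα y y.2]

/-- A Hopf subalgebra `L` is determined by `Rep(L^*)`: compare the annihilators of `L` and `L'`
through the cyclic module `H^* / L^⊥`, which belongs to `Rep(L^*)`. -/
lemma le_of_inRepDual {L L' : Subalgebra k H} (hL : IsHopfSubalgebra L)
    (h : ∀ (V : Type u) [AddCommGroup V] [Module k V] [Module (DualCop k H) V]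
      [IsScalarTower k (DualCop k H) V] [FiniteDimensional k V],
      InRepDual V L → InRepDual V L') : L ≤ L' := by
  have h₁ : InRepDual (DualCop k H ⧸ annihilatorIdeal hL) L := by
    intro α hα v
    obtain ⟨β, rfl⟩ := Submodule.Quotient.mk_surjective _ v
    rw [← Submodule.Quotient.mk_smul, Submodule.Quotient.mk_eq_zero]
    intro l hl
    rw [smul_eq_mul, DualCop.toDual_mul]
    obtain ⟨t, ht⟩ := hL.comul_mem l hl
    rw [← ht]
    clear ht
    induction t with
    | zero => simp
    | add x y hx hy => simp only [map_add, hx, hy, add_zero]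
    | tmul x y => simp [hα x x.2]
  have h₂ := h _ h₁
  intro l hl
  by_contra hl'
  obtain ⟨φ, hφ, hφ'⟩ := Submodule.exists_dual_map_eq_bot_of_notMem (p := L'.toSubmodule) hl'
    inferInstance
  refine hφ ?_
  have h₃ := h₂ (DualCop.toDual.symm φ) (fun l' hl' => ?_) (Submodule.Quotient.mk 1)
  · rw [← Submodule.Quotient.mk_smul, Submodule.Quotient.mk_eq_zero, smul_eq_mul, mul_one] at h₃
    exact h₃ l hl
  · have : φ l' ∈ Submodule.map φ L'.toSubmodule := ⟨l', hl', rfl⟩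
    rw [hφ', Submodule.mem_bot] at this
    exact this

lemma IsSubalgebraOfComponents.unique {F : Type*} {e : (F → k) →ₐ[k] DualCop k H} {X : Set F}
    {L L' : Subalgebra k H} (hL : IsSubalgebraOfComponents e X L)
    (hL' : IsSubalgebraOfComponents e X L') : L = L' :=
  le_antisymm
    (le_of_inRepDual hL.1 fun V _ _ _ _ _ hV => (hL'.2 V).2 ((hL.2 V).1 hV))
    (le_of_inRepDual hL'.1 fun V _ _ _ _ _ hV => (hL.2 V).2 ((hL'.2 V).1 hV))

end Uniqueness

/-! ### Images of central Hopf subalgebras -/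

section Image

variable {k U B : Type u} [Field k] [Ring U] [HopfAlgebra k U] [Ring B] [Bialgebra k B]
  [FiniteDimensional k B]

/-- A finite dimensional bialgebra quotient of a Hopf algebra has an antipode. Convolution by the
identity is injective on `End B`, since `f` is convolution invertible; by finite dimension it is
surjective. -/
lemma exists_antipode_of_surjective (f : U →ₐc[k] B) (hf : Function.Surjective f) :
    ∃ S : B →ₗ[k] B, ∀ u, S (f u) = f (antipode k u) := by
  have hinv : toConv ((f : U →ₐ[k] B).toLinearMap ∘ₗ antipode k) *
      toConv (f : U →ₐ[k] B).toLinearMap = 1 := by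
    have h := LinearMap.algHom_comp_convMul_distrib (f : U →ₐ[k] B)
      (toConv (antipode k (A := U))) (toConv LinearMap.id)
    rw [LinearMap.antipode_mul_id] at h
    refine (WithConv.ext h).symm.trans ?_
    ext u
    simp
  have hcomp : ∀ g : WithConv (B →ₗ[k] B),
      toConv ((toConv LinearMap.id * g).ofConv ∘ₗ (f : U →ₗc[k] B).toLinearMap) =
        toConv (f : U →ₐ[k] B).toLinearMap *
          toConv (g.ofConv ∘ₗ (f : U →ₗc[k] B).toLinearMap) := fun g =>
    WithConv.ext (LinearMap.convMul_comp_coalgHom_distrib _ _ (f : U →ₗc[k] B))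
  have hinj : Function.Injective (LinearMap.mulLeft k (toConv (LinearMap.id : B →ₗ[k] B))) := by
    rw [injective_iff_map_eq_zero]
    intro g hg
    have h := hcomp g
    rw [show toConv LinearMap.id * g = 0 from hg] at h
    have h' := congrArg (fun x => toConv ((f : U →ₐ[k] B).toLinearMap ∘ₗ antipode k) * x) h
    simp only [← mul_assoc, hinv, one_mul] at h'
    ext b
    obtain ⟨u, rfl⟩ := hf b
    have h₀ : toConv ((0 : WithConv (B →ₗ[k] B)).ofConv ∘ₗ (f : U →ₗc[k] B).toLinearMap) = 0 := by
      ext u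
      simp
    rw [h₀, mul_zero] at h'
    exact (congr(($h').ofConv u)).symm
  have : FiniteDimensional k (WithConv (B →ₗ[k] B)) :=
    Module.Finite.equiv (WithConv.linearEquiv k (B →ₗ[k] B)).symm
  obtain ⟨S, hS⟩ := (LinearMap.injective_iff_surjective.1 hinj) 1
  refine ⟨S.ofConv, fun u => ?_⟩
  have h := hcomp S
  rw [show toConv LinearMap.id * S = 1 from hS] at h
  have h₁ : toConv ((1 : WithConv (B →ₗ[k] B)).ofConv ∘ₗ (f : U →ₗc[k] B).toLinearMap) = 1 := by
    ext u
    simp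
  rw [h₁] at h
  exact congr(($(left_inv_eq_right_inv hinv h.symm)).ofConv u).symm

lemma IsHopfSubalgebra.map {f : U →ₐc[k] B} (hf : Function.Surjective f) {K : Subalgebra k U}
    (hK : IsHopfSubalgebra K) : IsHopfSubalgebra (K.map (f : U →ₐ[k] B)) where
  comul_mem := by
    rintro _ ⟨u, hu, rfl⟩
    obtain ⟨t, ht⟩ := hK.comul_mem u hu
    have h : comul (R := k) (f u) = TensorProduct.map (f : U →ₗc[k] B).toLinearMap
      (f : U →ₗc[k] B).toLinearMap (comul (R := k) u) :=
        (CoalgHomClass.map_comp_comul_apply f u).symm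
    change comul (R := k) (f u) ∈ _
    rw [h, ← ht]
    clear ht
    induction t with
    | zero => simp
    | add x y hx hy => simp only [map_add]; exact Submodule.add_mem _ hx hy
    | tmul x y => exact ⟨⟨_, x, x.2, rfl⟩ ⊗ₜ ⟨_, y, y.2, rfl⟩, rfl⟩
  exists_antipode := by
    obtain ⟨S, hS⟩ := exists_antipode_of_surjective f hf
    refine ⟨S, ?_⟩
    rintro _ ⟨u, hu, rfl⟩
    have h : comul (R := k) (f u) = TensorProduct.map (f : U →ₗc[k] B).toLinearMap
      (f : U →ₗc[k] B).toLinearMap (comul (R := k) u) :=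
        (CoalgHomClass.map_comp_comul_apply f u).symm
    have hε : counit (R := k) (f u) = counit (R := k) u := CoalgHomClass.counit_comp_apply f u
    have hl : ∀ t : U ⊗[k] U, LinearMap.mul' k B (S.rTensor B (TensorProduct.map
        (f : U →ₗc[k] B).toLinearMap (f : U →ₗc[k] B).toLinearMap t)) =
        f (LinearMap.mul' k U ((antipode k).rTensor U t)) := by
      intro t
      induction t with
      | zero => simp
      | add x y hx hy => simp only [map_add, hx, hy]
      | tmul x y => simp [hS]
    have hr : ∀ t : U ⊗[k] U, LinearMap.mul' k B (S.lTensor B (TensorProduct.map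
        (f : U →ₗc[k] B).toLinearMap (f : U →ₗc[k] B).toLinearMap t)) =
        f (LinearMap.mul' k U ((antipode k).lTensor U t)) := by
      intro t
      induction t with
      | zero => simp
      | add x y hx hy => simp only [map_add, hx, hy]
      | tmul x y => simp [hS]
    refine ⟨⟨antipode k u, ((isHopfSubalgebra_iff K).1 hK).2 u hu, (hS u).symm⟩, ?_, ?_⟩
    · change LinearMap.mul' k B (S.rTensor B (comul (R := k) (f u))) =
        algebraMap k B (counit (f u))
      rw [h, hl, mul_antipode_rTensor_comul_apply, hε]
      exact AlgHomClass.commutes f _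
    · change LinearMap.mul' k B (S.lTensor B (comul (R := k) (f u))) =
        algebraMap k B (counit (f u))
      rw [h, hr, mul_antipode_lTensor_comul_apply, hε]
      exact AlgHomClass.commutes f _

/-- A surjection maps the Hopf centre into the Hopf centre. -/
lemma IsHopfCentre.map_le {f : U →ₐc[k] B} (hf : Function.Surjective f) {K : Subalgebra k U}
    (hK : IsHopfCentre K) {K' : Subalgebra k B} (hK' : IsHopfCentre K') :
    K.map (f : U →ₐ[k] B) ≤ K' := by
  refine hK'.2 ⟨hK.1.1.map hf, ?_⟩
  rintro _ ⟨u, hu, rfl⟩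
  rw [Subalgebra.mem_center_iff]
  intro b
  obtain ⟨v, rfl⟩ := hf b
  change f v * f u = f u * f v
  rw [← map_mul, ← map_mul, (Subalgebra.mem_center_iff (R := k)).1 (hK.1.2 hu) v]

end Image

/-! ### Morphisms of dual group algebras -/

section DualGroup

variable {k : Type u} [Field k] {G F : Type*} [Group G] [Fintype G] [DecidableEq G]
  [Group F] [Fintype F] [DecidableEq F]

omit [Group G] in
/-- The characters of `kG^*` are the evaluations at points of `G`. -/
lemma exists_eq_eval (χ : (G → k) →ₐ[k] k) : ∃ g, ∀ φ, χ φ = φ g := by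
  obtain ⟨g, hg⟩ : ∃ g, χ (Pi.single g 1) ≠ 0 := by
    by_contra! h
    have := sum_algHom_single χ
    simp [h] at this
  have h₁ : χ (Pi.single g 1) = 1 := by
    have h : χ (Pi.single g 1) * χ (Pi.single g 1) = χ (Pi.single g 1) := by
      rw [← map_mul, ← Pi.single_mul, one_mul]
    exact mul_left_cancel₀ hg (h.trans (mul_one _).symm)
  refine ⟨g, fun φ => ?_⟩
  have h : χ φ = χ (φ * Pi.single g 1) := by rw [map_mul, h₁, mul_one]
  have h' : φ * Pi.single g 1 = φ g • Pi.single g (1 : k) := by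
    ext y
    by_cases h : y = g
    · subst h; simp
    · simp [h]
  rw [h, h', map_smul, h₁, smul_eq_mul, mul_one]

/-- A bialgebra morphism that maps `kG^* ⊆ A` into `kF^* ⊆ B` is dual to a group morphism
`F → G`. -/
lemma IsDualGroupEmbedding.exists_monoidHom {A B : Type u} [Ring A] [Bialgebra k A] [Ring B]
    [Bialgebra k B] (f : A →ₐc[k] B) {eG : (G → k) →ₐ[k] A} (heG : IsDualGroupEmbedding eG)
    {eF : (F → k) →ₐ[k] B} (heF : IsDualGroupEmbedding eF)
    (hle : eG.range.map (f : A →ₐ[k] B) ≤ eF.range) :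
    ∃ fStar : F →* G, ∀ φ : G → k, f (eG φ) = eF (φ ∘ fStar) := by
  let r : (G → k) →ₐ[k] (F → k) := (AlgEquiv.ofInjective eF heF.injective).symm.toAlgHom.comp
    (((f : A →ₐ[k] B).comp eG).codRestrict eF.range fun φ => hle ⟨eG φ, ⟨φ, rfl⟩, rfl⟩)
  have hr : ∀ φ, f (eG φ) = eF (r φ) := by
    intro φ
    exact (congrArg Subtype.val ((AlgEquiv.ofInjective eF heF.injective).apply_symm_apply
      ⟨f (eG φ), hle ⟨eG φ, ⟨φ, rfl⟩, rfl⟩⟩)).symm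
  choose s hs using fun x : F => exists_eq_eval ((Pi.evalAlgHom k (fun _ : F => k) x).comp r)
  have hs' : ∀ φ, f (eG φ) = eF (φ ∘ s) := by
    intro φ
    rw [hr]
    congr 1
    ext x
    exact hs x φ
  -- evaluation at points of `F`, extended from `kF^*` to functionals on `B`
  obtain ⟨l, hl⟩ := eF.toLinearMap.exists_leftInverse_of_injective
    (LinearMap.ker_eq_bot.2 heF.injective)
  have hl' : ∀ ψ, l (eF ψ) = ψ := fun ψ => congr($hl ψ)
  refine ⟨MonoidHom.mk' s fun x y => ?_, hs'⟩
  let T : B ⊗[k] B →ₗ[k] k := LinearMap.mul' k k ∘ₗ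
    TensorProduct.map (LinearMap.proj x ∘ₗ l) (LinearMap.proj y ∘ₗ l)
  have hT : ∀ φ ψ, T (eF φ ⊗ₜ eF ψ) = φ x * ψ y := fun φ ψ => by simp [T, hl']
  have hF : ∀ ψ : F → k, T (comul (R := k) (eF ψ)) = ψ (x * y) := by
    intro ψ
    rw [algHom_eq_sum_single]
    simp only [map_sum, map_smul, heF.comul_single, hT]
    rw [Finset.sum_eq_single (x * y)]
    · rw [Finset.sum_eq_single x]
      · simp
      · intro b _ hb
        simp [hb.symm]
      · simp
    · intro z _ hz
      have hy : y ≠ x⁻¹ * z := fun h => hz (by rw [h]; group)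
      rw [Finset.sum_eq_single x]
      · simp [Pi.single_eq_of_ne hy]
      · intro b _ hb
        simp [hb.symm]
      · simp
    · simp
  have h := CoalgHomClass.map_comp_comul_apply f (eG (Pi.single (s x * s y) 1))
  rw [hs', heG.comul_single, map_sum] at h
  have h' := congrArg T h
  rw [hF, map_sum, Finset.sum_eq_single (s x)] at h'
  · have h₂ : T (eF ((Pi.single (s x) 1 : G → k) ∘ s) ⊗ₜ
        eF ((Pi.single ((s x)⁻¹ * (s x * s y)) 1 : G → k) ∘ s)) =
        (Pi.single (s x * s y) 1 : G → k) (s (x * y)) := by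
      rw [← hs', ← hs']
      exact h'
    rw [hT] at h₂
    by_contra hne
    simp [Pi.single_eq_of_ne hne] at h₂
  · intro b _ hb
    have h₂ : T (eF ((Pi.single b 1 : G → k) ∘ s) ⊗ₜ
        eF ((Pi.single (b⁻¹ * (s x * s y)) 1 : G → k) ∘ s)) = 0 := by
      rw [hT]
      simp [Pi.single_eq_of_ne hb.symm]
    rw [← hs', ← hs'] at h₂
    exact h₂
  · simp

end DualGroup

/-! ### Dual group algebras inside Hopf algebras -/

namespace IsDualGroupEmbedding

variable {k A : Type u} [Field k] [Ring A] [HopfAlgebra k A] {G : Type*} [Group G] [Fintype G]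
  [DecidableEq G] {e : (G → k) →ₐ[k] A} (he : IsDualGroupEmbedding e)
include he

/-- The antipode of an indicator function, from the antipode identity at `p_{g h}` multiplied by
`p_h`. -/
lemma antipode_single (g : G) : antipode k (e (Pi.single g 1)) = e (Pi.single g⁻¹ 1) := by
  have key : ∀ h : G, antipode k (e (Pi.single g 1)) * e (Pi.single h 1) =
      if g⁻¹ = h then e (Pi.single h 1) else 0 := by
    intro h
    have h₁ := mul_antipode_rTensor_comul_apply (R := k) (e (Pi.single (g * h) 1))
    rw [he.comul_single, map_sum, map_sum, he.counit_apply] at h₁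
    simp only [LinearMap.rTensor_tmul, LinearMap.mul'_apply] at h₁
    have h₂ := congrArg (fun x => x * e (Pi.single h 1)) h₁
    simp only [Finset.sum_mul, mul_assoc, algHom_single_mul_algHom_single] at h₂
    rw [Finset.sum_eq_single g] at h₂
    · rw [if_pos (by group), inv_mul_cancel_left] at h₂
      rw [h₂]
      by_cases hg : g⁻¹ = h
      · subst hg
        simp
      · rw [if_neg hg, Pi.single_eq_of_ne, map_zero, zero_mul]
        rintro h₃
        exact hg (inv_eq_of_mul_eq_one_right h₃.symm)
    · intro x _ hx
      rw [if_neg, mul_zero]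
      intro h₃
      refine hx ?_
      have : g * h = x * h := by rw [← inv_mul_eq_iff_eq_mul, h₃]
      exact (mul_right_cancel this).symm
    · simp
  rw [← mul_one (antipode k (e (Pi.single g 1))), ← sum_algHom_single e, Finset.mul_sum]
  simp only [key]
  simp

lemma isHopfSubalgebra_range : IsHopfSubalgebra e.range := by
  rw [isHopfSubalgebra_iff]
  constructor
  · rintro _ ⟨φ, rfl⟩
    change comul (R := k) (e φ) ∈ _
    rw [algHom_eq_sum_single, map_sum]
    refine Submodule.sum_mem _ fun g _ => ?_
    rw [map_smul, he.comul_single]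
    refine Submodule.smul_mem _ _ (Submodule.sum_mem _ fun x _ => ?_)
    exact ⟨⟨_, Pi.single x 1, rfl⟩ ⊗ₜ ⟨_, Pi.single (x⁻¹ * g) 1, rfl⟩, rfl⟩
  · rintro _ ⟨φ, rfl⟩
    change antipode k (e φ) ∈ _
    rw [algHom_eq_sum_single, map_sum]
    refine Subalgebra.sum_mem _ fun g _ => ?_
    rw [map_smul, he.antipode_single]
    exact Subalgebra.smul_mem _ (AlgHom.mem_range_self e _) _

end IsDualGroupEmbedding

/-! ### The grading of the generalized quantum double -/

namespace GenDouble

section Grading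

variable {k U H : Type u} [Field k] [Ring U] [HopfAlgebra k U] [Ring H] [HopfAlgebra k H]
  [FiniteDimensional k H] (f : U →ₐc[k] DualCop k H) {F : Type*} [Group F] [Fintype F]
  [DecidableEq F] {q : F → ConvDual k H}

/-- The functional `u ⋈ a ↦ ε(u) φ(a)` on the double. -/
def extend (φ : ConvDual k H) : ConvDual k (GenDouble f) :=
  toConv (LinearMap.mul' k k ∘ₗ TensorProduct.map (counit (R := k) (A := U)) φ.ofConv)

lemma extend_mk (φ : ConvDual k H) (u : U) (a : H) :
    (extend f φ).ofConv (mk f u a) = counit (R := k) u * φ.ofConv a := rfl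

lemma lAct_extend_mk (φ : ConvDual k H) (u : U) (a : H) :
    lAct (extend f φ) (mk f u a) = mk f u (lAct φ a) := by
  rw [lAct_apply, comul_mk, lAct_apply]
  have h : ∀ (s : U ⊗[k] U) (t : H ⊗[k] H),
      TensorProduct.rid k _ ((extend f φ).ofConv.lTensor _ (shuffle f (s ⊗ₜ t))) =
        mk f (TensorProduct.rid k U ((counit (R := k)).lTensor U s))
          (TensorProduct.rid k H (φ.ofConv.lTensor H t)) := by
    intro s t
    induction s with
    | zero => simp
    | add x y hx hy => simp only [map_add, add_tmul, LinearMap.add_apply, hx, hy]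
    | tmul u v =>
      induction t with
      | zero => simp
      | add x y hx hy => simp only [map_add, tmul_add, hx, hy]
      | tmul b c => simp [shuffle_tmul, extend_mk, smul_smul, mul_comm]
  rw [h, lTensor_counit_comul]
  simp

lemma rAct_extend_mk (φ : ConvDual k H) (u : U) (a : H) :
    rAct (extend f φ) (mk f u a) = mk f u (rAct φ a) := by
  rw [rAct_apply, comul_mk, rAct_apply]
  have h : ∀ (s : U ⊗[k] U) (t : H ⊗[k] H),
      TensorProduct.lid k _ ((extend f φ).ofConv.rTensor _ (shuffle f (s ⊗ₜ t))) =
        mk f (TensorProduct.lid k U ((counit (R := k)).rTensor U s))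
          (TensorProduct.lid k H (φ.ofConv.rTensor H t)) := by
    intro s t
    induction s with
    | zero => simp
    | add x y hx hy => simp only [map_add, add_tmul, LinearMap.add_apply, hx, hy]
    | tmul u v =>
      induction t with
      | zero => simp
      | add x y hx hy => simp only [map_add, tmul_add, hx, hy]
      | tmul b c => simp [shuffle_tmul, extend_mk, smul_smul, mul_comm]
  rw [h, rTensor_counit_comul]
  simp

lemma convDual_ext {φ ψ : ConvDual k (GenDouble f)}
    (h : ∀ u a, φ.ofConv (mk f u a) = ψ.ofConv (mk f u a)) : φ = ψ := by
  ext x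
  induction x using GenDouble.induction with
  | zero => simp
  | add x y hx hy => simp only [map_add, hx, hy]
  | mk u a => exact h u a

/-- Left multiplication by `h ∈ H` in terms of the operators `opLeft` and `opBeta`. -/
lemma leftH_eq_sum (a : H) (x : GenDouble f) : leftH f a x = ∑ i ∈ (ℛ k a).index,
    opLeft f ((ℛ k a).left i) (opBeta f ((ℛ k a).right i) x) := by
  have h := congrArg (fun T => T x)
    ((ℛ k a).convMul_apply (toConv (opLeft f)) (toConv (opBeta f)))
  rw [← leftH_conv] at h
  simpa [LinearMap.sum_apply] using h

variable {f}

lemma extend_opLeft (hq : CocentralGrading q) (x : F) (a : H) (v : U) (b : H) :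
    (extend f (q x)).ofConv (opLeft f a (mk f v b)) =
      ∑ s, (q s).ofConv b * (lam f (lAct (q (s⁻¹ * x)) a)).ofConv v := by
  have hr : ∀ φ : ConvDual k U, counit (R := k) (rAct φ v) = φ.ofConv v := by
    intro φ
    have h := convDual_mul_apply_rAct φ 1 v
    rw [mul_one] at h
    exact h.symm
  have h : ∀ t : H ⊗[k] H, (extend f (q x)).ofConv (opLeftTwo f t (mk f v b)) =
      ∑ s, (q s).ofConv b * (lam f (TensorProduct.rid k H
        ((q (s⁻¹ * x)).ofConv.lTensor H t))).ofConv v := by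
    intro t
    induction t with
    | zero => simp
    | add y z hy hz =>
      simp only [map_add, ofConv_add, mul_add, LinearMap.add_apply, hy, hz,
        Finset.sum_add_distrib]
    | tmul c d =>
      refine (extend_mk f (q x) (alphaHom f c v) (d * b)).trans ?_
      rw [alphaHom_apply, hr, hq.apply_mul, Finset.mul_sum]
      refine Finset.sum_congr rfl fun s _ => ?_
      simp
      ring
  exact h (comul (R := k) a)

/-- The factors `λ` and `λ⁻¹` in the product cancel: as the `q s` are central, they project `a` to
its components before it is split, and `λ(v₁, a₁) λ⁻¹(v₂, a₂) = ε(v) ε(a)` for every component. -/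
lemma extend_leftH (hq : CocentralGrading q) (x : F) (a : H) (y : GenDouble f) :
    (extend f (q x)).ofConv (leftH f a y) =
      ∑ s, (extend f (q s)).ofConv y * (q (s⁻¹ * x)).ofConv a := by
  induction y using GenDouble.induction with
  | zero => simp
  | add y z hy hz => simp only [map_add, add_mul, Finset.sum_add_distrib, hy, hz]
  | mk v b =>
    have key : ∀ (P : Module.End k H), ∑ i ∈ (ℛ k a).index,
        (lam f (P ((ℛ k a).left i))).ofConv (betaHom f ((ℛ k a).right i) v) =
        (LinearMap.mul' k (ConvDual k U) (TensorProduct.map (lam f) (lamInv f)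
          (P.rTensor H (comul (R := k) a)))).ofConv v := by
      intro P
      conv_rhs => rw [← (ℛ k a).eq]
      simp only [map_sum, LinearMap.rTensor_tmul, TensorProduct.map_tmul, LinearMap.mul'_apply,
        ofConv_sum, LinearMap.sum_apply, convDual_mul_apply_lAct]
      rfl
    have hε : ∀ b : H, LinearMap.mul' k (ConvDual k U) (TensorProduct.map (lam f) (lamInv f)
        (comul (R := k) b)) = algebraMap k _ (counit b) := fun b =>
      congr(($(lam_conv_lamInv f)).ofConv b)
    rw [leftH_eq_sum, map_sum]
    simp only [opBeta_mk, extend_opLeft hq]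
    rw [Finset.sum_comm]
    refine Finset.sum_congr rfl fun s _ => ?_
    rw [← Finset.mul_sum, key, ← hq.comul_lAct_left, hε, counit_lAct, extend_mk,
      Algebra.algebraMap_eq_smul_one]
    change _ * ((q (s⁻¹ * x)).ofConv a * counit (R := k) v) = _
    ring

lemma extend_leftU (φ : ConvDual k H) (u : U) (y : GenDouble f) :
    (extend f φ).ofConv (leftU f u y) = counit (R := k) u * (extend f φ).ofConv y := by
  induction y using GenDouble.induction with
  | zero => simp
  | add y z hy hz => simp only [map_add, mul_add, hy, hz]
  | mk v b => simp [leftU_mk, extend_mk, mul_assoc]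

/-- A cocentral grading of `H` induces one of `D_f(U, H)`, with components `U ⊗ H_x`. -/
lemma cocentralGrading_extend (hq : CocentralGrading q) :
    CocentralGrading (fun x => extend f (q x)) where
  mul_eq x y := by
    refine convDual_ext f fun u a => ?_
    rw [convDual_mul_apply_lAct, lAct_extend_mk, extend_mk, ← convDual_mul_apply_lAct, hq.mul_eq]
    split_ifs <;> simp [extend_mk]
  sum_eq := by
    refine convDual_ext f fun u a => ?_
    rw [ofConv_sum, LinearMap.sum_apply]
    simp only [extend_mk]
    rw [← Finset.mul_sum, hq.sum_apply, ← counit_mk]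
    rfl
  comm x φ := by
    refine convDual_ext f fun u a => ?_
    rw [convDual_mul_apply_rAct, convDual_mul_apply_lAct φ, lAct_extend_mk, rAct_extend_mk,
      hq.rAct_eq]
  apply_mul x a b := by
    induction b using GenDouble.induction with
    | zero => simp
    | add y z hy hz => simp only [map_add, mul_add, add_mul, Finset.sum_add_distrib, hy, hz]
    | mk u h =>
      rw [← ofU_mul_ofH, mul_assoc, ofU_mul, ofH_mul, extend_leftU, extend_leftH hq,
        Finset.mul_sum]
      refine Finset.sum_congr rfl fun s _ => ?_
      rw [ofU_mul_ofH, extend_mk]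
      ring
  apply_one x := by
    rw [one_def, extend_mk, hq.apply_one]
    simp

/-- The homogeneous part of the double over a set of degrees is `U ⋈ L`, for `L` the homogeneous
part of `H`. -/
lemma part_extend (hq : CocentralGrading q) (N : Set F) {L : Subalgebra k H}
    (hL : L.toSubmodule = CocentralGrading.part q N) :
    CocentralGrading.part (fun x => extend f (q x)) N = bowtie f L := by
  apply le_antisymm
  · intro a ha
    rw [← (cocentralGrading_extend hq).sum_lAct a]
    refine Submodule.sum_mem _ fun x _ => ?_
    by_cases hx : x ∈ N
    · clear ha
      induction a using GenDouble.induction with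
      | zero => simp
      | add y z hy hz => rw [map_add]; exact Submodule.add_mem _ hy hz
      | mk u h =>
        rw [lAct_extend_mk]
        refine Submodule.subset_span ⟨u, _, ?_, rfl⟩
        rw [← Subalgebra.mem_toSubmodule, hL]
        exact hq.lAct_mem_part hx h
    · rw [ha x hx]
      exact Submodule.zero_mem _
  · refine Submodule.span_le.2 ?_
    rintro _ ⟨u, l, hl, rfl⟩ y hy
    rw [← Subalgebra.mem_toSubmodule, hL] at hl
    rw [lAct_extend_mk, hl y hy, map_zero]

end Grading
end GenDouble

/-! ### The adjoint actions of the double on `kG^*` -/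

section Adjoint

variable {k A : Type u} [Field k] [Ring A] [HopfAlgebra k A]

lemma leftAdj_repr {ι : Type*} (b : A) {a : A} (r : Coalgebra.Repr k a ι) :
    leftAdj (k := k) b a = ∑ i ∈ r.index, r.left i * b * antipode k (r.right i) := by
  rw [leftAdj, LinearMap.comp_apply, LinearMap.comp_apply, ← r.eq]
  simp

lemma rightAdj_repr {ι : Type*} (b : A) {a : A} (r : Coalgebra.Repr k a ι) :
    rightAdj (k := k) b a = ∑ i ∈ r.index, antipode k (r.left i) * b * r.right i := by
  change LinearMap.mul' k A (TensorProduct.map (antipode k)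
    (LinearMap.mulLeft k b) (comul (R := k) a)) = _
  rw [← r.eq]
  simp [mul_assoc]

end Adjoint

namespace GenDouble

section Double

variable {k U H : Type u} [Field k] [Ring U] [HopfAlgebra k U] [Ring H] [HopfAlgebra k H]
  [FiniteDimensional k H] {f : U →ₐc[k] DualCop k H} {G F : Type*}
  [Group G] [Fintype G] [DecidableEq G] [Group F] [Fintype F] [DecidableEq F]
  {eG : (G → k) →ₐ[k] U} {eF : (F → k) →ₐ[k] DualCop k H} {s : F →* G}

omit [Fintype G] in
lemma lam_single (hs : ∀ φ, f (eG φ) = eF (φ ∘ s)) (a : H) (g : G) :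
    (lam f a).ofConv (eG (Pi.single g 1)) =
      ∑ y, if s y = g then (degreeFunctional eF y).ofConv a else 0 := by
  rw [lam_apply, hs, algHom_eq_sum_single, map_sum, LinearMap.sum_apply]
  refine Finset.sum_congr rfl fun y _ => ?_
  rw [map_smul, LinearMap.smul_apply, Function.comp_apply, Pi.single_apply]
  split_ifs
  · rw [one_smul]
    rfl
  · rw [zero_smul]

lemma lamInv_single (heG : IsDualGroupEmbedding eG) (hs : ∀ φ, f (eG φ) = eF (φ ∘ s)) (a : H)
    (g : G) : (lamInv f a).ofConv (eG (Pi.single g 1)) =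
      ∑ y, if s y = g⁻¹ then (degreeFunctional eF y).ofConv a else 0 := by
  rw [lamInv_apply, heG.antipode_single, ← lam_apply, lam_single hs]

lemma alphaHom_single (heG : IsDualGroupEmbedding eG) (hs : ∀ φ, f (eG φ) = eF (φ ∘ s)) (a : H)
    (g : G) : alphaHom f a (eG (Pi.single g 1)) =
      ∑ y, (degreeFunctional eF y).ofConv a • eG (Pi.single ((s y)⁻¹ * g) 1) := by
  rw [alphaHom_apply, rAct_apply, heG.comul_single]
  simp only [map_sum, LinearMap.rTensor_tmul, lid_tmul, lam_single hs, Finset.sum_smul]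
  rw [Finset.sum_comm]
  refine Finset.sum_congr rfl fun y _ => ?_
  simp [ite_smul]

lemma betaHom_single (heG : IsDualGroupEmbedding eG) (hs : ∀ φ, f (eG φ) = eF (φ ∘ s)) (a : H)
    (g : G) : betaHom f a (eG (Pi.single g 1)) =
      ∑ y, (degreeFunctional eF y).ofConv a • eG (Pi.single (g * s y) 1) := by
  rw [betaHom_apply, lAct_apply, heG.comul_single]
  simp only [map_sum, LinearMap.lTensor_tmul, rid_tmul, lamInv_single heG hs, Finset.sum_smul]
  rw [Finset.sum_comm]
  refine Finset.sum_congr rfl fun y _ => ?_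
  rw [Finset.sum_eq_single (g * s y)]
  · rw [if_pos (by group)]
  · intro x _ hx
    rw [if_neg, zero_smul]
    intro h
    refine hx ?_
    rw [h, mul_inv_rev, inv_inv, mul_inv_cancel_left]
  · simp

variable (heG : IsDualGroupEmbedding eG) (hs : ∀ φ, f (eG φ) = eF (φ ∘ s))
  (hq : CocentralGrading (degreeFunctional eF))
include heG hs hq

/-- Moving `a ∈ H` past an indicator function conjugates the function by the degree of `a`. The
factor `λ(p, a₁)` picks the degree of `a₁`, the factor `λ⁻¹(p, a₃)` the inverse of that of `a₃`,
and by cocentrality both are the degree of `a`. -/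
lemma ofH_mul_ofGroup (a : H) (g : G) :
    ofH f a * ofGroup f eG (Pi.single g 1) =
      ∑ y, ofGroup f eG (Pi.single ((s y)⁻¹ * g * s y) 1) *
        ofH f (lAct (degreeFunctional eF y) a) := by
  have hleft : ∀ (b : H) (g : G), opLeft f b (mk f (eG (Pi.single g 1)) 1) =
      ∑ y, mk f (eG (Pi.single ((s y)⁻¹ * g) 1)) (lAct (degreeFunctional eF y) b) := by
    intro b g
    have h : opLeft f b (mk f (eG (Pi.single g 1)) 1) = ∑ i ∈ (ℛ k b).index,
        opAlpha f ((ℛ k b).left i) (opMul f ((ℛ k b).right i) (mk f (eG (Pi.single g 1)) 1)) := by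
      have h := congrArg (fun T => T (mk f (eG (Pi.single g 1)) 1))
        ((ℛ k b).convMul_apply (toConv (opAlpha f)) (toConv (opMul f)))
      rw [← opLeft_conv] at h
      simpa [LinearMap.sum_apply] using h
    rw [h]
    simp only [opMul_mk, opAlpha_mk, mul_one, alphaHom_single heG hs, map_sum,
      LinearMap.sum_apply, map_smul, LinearMap.smul_apply, ← hq.rAct_eq, rAct_repr _ (ℛ k b)]
    exact Finset.sum_comm
  change ofH f a * mk f (eG (Pi.single g 1)) 1 = _
  rw [ofH_mul, leftH_eq_sum]
  simp only [opBeta_mk, betaHom_single heG hs, map_sum, LinearMap.sum_apply, map_smul,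
    LinearMap.smul_apply]
  rw [Finset.sum_comm]
  refine Finset.sum_congr rfl fun y _ => ?_
  have hsum : opLeft f (lAct (degreeFunctional eF y) a) (mk f (eG (Pi.single (g * s y) 1)) 1) =
      ∑ i ∈ (ℛ k a).index, (degreeFunctional eF y).ofConv ((ℛ k a).right i) •
        opLeft f ((ℛ k a).left i) (mk f (eG (Pi.single (g * s y) 1)) 1) := by
    rw [lAct_repr _ (ℛ k a)]
    simp [LinearMap.sum_apply]
  rw [← hsum, hleft, Finset.sum_eq_single y]
  · rw [hq.lAct_lAct, if_pos rfl, mul_assoc]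
    exact (ofU_mul_ofH f _ _).symm
  · intro x _ hx
    rw [hq.lAct_lAct, if_neg hx, map_zero]
  · simp

lemma ofGroup_mul_ofH (a : H) (g : G) :
    ofGroup f eG (Pi.single g 1) * ofH f a =
      ∑ y, ofH f (lAct (degreeFunctional eF y) a) *
        ofGroup f eG (Pi.single (s y * g * (s y)⁻¹) 1) := by
  conv_lhs => rw [← hq.sum_lAct a, map_sum, Finset.mul_sum]
  refine Finset.sum_congr rfl fun y _ => ?_
  rw [ofH_mul_ofGroup heG hs hq, Finset.sum_eq_single y]
  · rw [hq.lAct_lAct, if_pos rfl]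
    congr 4
    group
  · intro x _ hx
    rw [hq.lAct_lAct, if_neg hx, map_zero, mul_zero]
  · simp

variable (hc : eG.range ≤ Subalgebra.center k U)
include hc

omit heG hs hq [Group F] [Fintype F] [DecidableEq F] [Group G] [Fintype G] [DecidableEq G] in
lemma ofU_mul_ofGroup (u : U) (φ : G → k) :
    ofU f u * ofGroup f eG φ = ofGroup f eG φ * ofU f u := by
  have h := (Subalgebra.mem_center_iff (R := k)).1 (hc ⟨φ, rfl⟩) u
  refine (map_mul (ofU f) u (eG φ)).symm.trans ((congrArg (ofU f) h).trans ?_)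
  exact map_mul (ofU f) (eG φ) u

lemma leftAdj_single (g : G) (a : GenDouble f) :
    leftAdj (k := k) (ofGroup f eG (Pi.single g 1)) a =
      ∑ y, (extend f (degreeFunctional eF y)).ofConv a •
        ofGroup f eG (Pi.single ((s y)⁻¹ * g * s y) 1) := by
  induction a using GenDouble.induction with
  | zero => simp
  | add a b ha hb => simp only [map_add, add_smul, Finset.sum_add_distrib, ha, hb]
  | mk u h =>
    have hH : ∑ j ∈ (ℛ k h).index, ofH f ((ℛ k h).left j) * ofGroup f eG (Pi.single g 1) *
        ofH f (antipode k ((ℛ k h).right j)) =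
        ∑ y, (degreeFunctional eF y).ofConv h •
          ofGroup f eG (Pi.single ((s y)⁻¹ * g * s y) 1) := by
      simp only [ofH_mul_ofGroup heG hs hq, Finset.sum_mul]
      rw [Finset.sum_comm]
      refine Finset.sum_congr rfl fun y _ => ?_
      simp only [mul_assoc, ← map_mul (ofH f)]
      rw [← Finset.mul_sum, ← map_sum]
      have h₁ := mul_antipode_lTensor_comul_apply (R := k) (lAct (degreeFunctional eF y) h)
      rw [hq.comul_lAct_left, ← (ℛ k h).eq, counit_lAct] at h₁
      simp only [map_sum, LinearMap.rTensor_tmul, LinearMap.lTensor_tmul,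
        LinearMap.mul'_apply] at h₁
      rw [h₁, AlgHom.commutes, ← Algebra.commutes, ← Algebra.smul_def]
    rw [leftAdj_repr _ (reprMk f (ℛ k u) (ℛ k h))]
    have hterm : ∀ i j, mk f ((ℛ k u).left i) ((ℛ k h).left j) *
        ofGroup f eG (Pi.single g 1) *
        antipode k (mk f ((ℛ k u).right i) ((ℛ k h).right j)) =
        ofU f ((ℛ k u).left i) * (ofH f ((ℛ k h).left j) * ofGroup f eG (Pi.single g 1) *
          ofH f (antipode k ((ℛ k h).right j))) * ofU f (antipode k ((ℛ k u).right i)) := by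
      intro i j
      rw [← ofU_mul_ofH, show antipode k (mk f ((ℛ k u).right i) ((ℛ k h).right j)) =
        ofH f (antipode k ((ℛ k h).right j)) * ofU f (antipode k ((ℛ k u).right i)) from rfl]
      simp only [mul_assoc]
    refine (Finset.sum_product _ _ _).trans ?_
    refine (Finset.sum_congr rfl fun i _ => Finset.sum_congr rfl fun j _ => hterm i j).trans ?_
    simp only [← Finset.mul_sum, ← Finset.sum_mul, hH]
    simp only [Finset.mul_sum, Finset.sum_mul, mul_smul_comm, smul_mul_assoc,
      ofU_mul_ofGroup hc]
    rw [Finset.sum_comm]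
    refine Finset.sum_congr rfl fun y _ => ?_
    simp only [mul_assoc, ← map_mul (ofU f)]
    rw [← Finset.smul_sum, ← Finset.mul_sum, ← map_sum, sum_mul_antipode_eq_algebraMap_counit,
      AlgHom.commutes, ← Algebra.commutes, ← Algebra.smul_def, smul_smul, extend_mk, mul_comm]

lemma rightAdj_single (g : G) (a : GenDouble f) :
    rightAdj (k := k) (ofGroup f eG (Pi.single g 1)) a =
      ∑ y, (extend f (degreeFunctional eF y)).ofConv a •
        ofGroup f eG (Pi.single (s y * g * (s y)⁻¹) 1) := by
  induction a using GenDouble.induction with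
  | zero => simp
  | add a b ha hb => simp only [map_add, add_smul, Finset.sum_add_distrib, ha, hb]
  | mk u h =>
    have hH : ∑ j ∈ (ℛ k h).index, ofH f (antipode k ((ℛ k h).left j)) *
        (ofGroup f eG (Pi.single g 1) * ofH f ((ℛ k h).right j)) =
        ∑ y, (degreeFunctional eF y).ofConv h •
          ofGroup f eG (Pi.single (s y * g * (s y)⁻¹) 1) := by
      simp only [ofGroup_mul_ofH heG hs hq, Finset.mul_sum]
      rw [Finset.sum_comm]
      refine Finset.sum_congr rfl fun y _ => ?_
      simp only [← mul_assoc, ← map_mul (ofH f)]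
      rw [← Finset.sum_mul, ← map_sum]
      have h₁ := mul_antipode_rTensor_comul_apply (R := k) (lAct (degreeFunctional eF y) h)
      rw [comul_lAct, ← (ℛ k h).eq, counit_lAct] at h₁
      simp only [map_sum, LinearMap.rTensor_tmul, LinearMap.lTensor_tmul,
        LinearMap.mul'_apply] at h₁
      rw [h₁, AlgHom.commutes, ← Algebra.smul_def]
    rw [rightAdj_repr _ (reprMk f (ℛ k u) (ℛ k h))]
    have hterm : ∀ i j, antipode k (mk f ((ℛ k u).left i) ((ℛ k h).left j)) *
        ofGroup f eG (Pi.single g 1) * mk f ((ℛ k u).right i) ((ℛ k h).right j) =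
        ofH f (antipode k ((ℛ k h).left j)) *
          (ofU f (antipode k ((ℛ k u).left i) * (ℛ k u).right i) *
            (ofGroup f eG (Pi.single g 1) * ofH f ((ℛ k h).right j))) := by
      intro i j
      rw [show antipode k (mk f ((ℛ k u).left i) ((ℛ k h).left j)) =
        ofH f (antipode k ((ℛ k h).left j)) * ofU f (antipode k ((ℛ k u).left i)) from rfl,
        ← ofU_mul_ofH, map_mul (ofU f)]
      have h₁ := ofU_mul_ofGroup (f := f) hc ((ℛ k u).right i) (Pi.single g 1)
      simp only [mul_assoc]
      rw [← mul_assoc (ofGroup f eG (Pi.single g 1)), ← h₁, mul_assoc]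
    refine (Finset.sum_product_right _ _ _).trans ?_
    refine (Finset.sum_congr rfl fun j _ => Finset.sum_congr rfl fun i _ => hterm i j).trans ?_
    simp only [← Finset.mul_sum, ← Finset.sum_mul, ← map_sum,
      sum_antipode_mul_eq_algebraMap_counit, AlgHom.commutes, ← Algebra.smul_def]
    simp only [mul_smul_comm, ← Finset.smul_sum]
    rw [hH, Finset.smul_sum]
    simp only [smul_smul, extend_mk]

/-- The right adjoint action of `a` of degree `y` conjugates functions on `G` by `s y`. -/
lemma rightAdj_ofGroup (φ : G → k) (a : GenDouble f) :
    rightAdj (k := k) (ofGroup f eG φ) a =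
      ∑ y, (extend f (degreeFunctional eF y)).ofConv a •
        ofGroup f eG (fun h => φ ((s y)⁻¹ * h * s y)) := by
  rw [algHom_eq_sum_single, map_sum, LinearMap.sum_apply]
  simp only [map_smul, LinearMap.smul_apply, rightAdj_single heG hs hq hc, Finset.smul_sum]
  rw [Finset.sum_comm]
  refine Finset.sum_congr rfl fun y _ => ?_
  simp only [smul_comm _ ((extend f (degreeFunctional eF y)).ofConv a)]
  rw [← Finset.smul_sum, algHom_eq_sum_single _ (fun h => φ ((s y)⁻¹ * h * s y))]
  congr 1
  refine Fintype.sum_equiv (MulAut.conj (s y)).toEquiv _ _ fun h => ?_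
  simp only [MulEquiv.toEquiv_eq_coe, EquivLike.coe_coe, MulAut.conj_apply]
  congr 2
  group

omit hs hq hc [Fintype F] [Group F] [DecidableEq F] in
lemma isDualGroupEmbedding_ofGroup : IsDualGroupEmbedding (ofGroup f eG) where
  injective := ofGroup_injective f heG.injective
  comul_single g := by
    change comul (R := k) (mk f (eG (Pi.single g 1)) 1) = _
    rw [comul_mk, heG.comul_single, Bialgebra.comul_one, Algebra.TensorProduct.one_def,
      sum_tmul, map_sum]
    rfl
  counit_apply φ := by
    change counit (R := k) (mk f (eG φ) 1) = _
    rw [counit_mk, heG.counit_apply, Bialgebra.counit_one, mul_one]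

lemma isNormalHopfSubalgebra_ofGroup : IsNormalHopfSubalgebra (ofGroup f eG).range where
  isHopfSubalgebra := (isDualGroupEmbedding_ofGroup heG).isHopfSubalgebra_range
  leftAdj_mem := by
    rintro _ ⟨φ, rfl⟩ a
    change leftAdj (k := k) (ofGroup f eG φ) a ∈ _
    have h : leftAdj (k := k) (ofGroup f eG φ) a =
        ∑ g, φ g • leftAdj (k := k) (ofGroup f eG (Pi.single g 1)) a := by
      simp only [leftAdj_repr _ (ℛ k a)]
      rw [algHom_eq_sum_single]
      simp only [Finset.mul_sum, Finset.sum_mul, Finset.smul_sum, mul_smul_comm, smul_mul_assoc]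
      exact Finset.sum_comm
    rw [h]
    refine Subalgebra.sum_mem _ fun g _ => Subalgebra.smul_mem _ ?_ _
    rw [leftAdj_single heG hs hq hc]
    exact Subalgebra.sum_mem _ fun y _ => Subalgebra.smul_mem _ (AlgHom.mem_range_self _ _) _
  rightAdj_mem := by
    rintro _ ⟨φ, rfl⟩ a
    change rightAdj (k := k) (ofGroup f eG φ) a ∈ _
    rw [rightAdj_ofGroup heG hs hq hc]
    exact Subalgebra.sum_mem _ fun y _ => Subalgebra.smul_mem _ (AlgHom.mem_range_self _ _) _

end Double

end GenDouble

/-! ### Modules over the dual of a cocentrally graded Hopf algebra -/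

section Modules

variable {k A : Type u} [Field k] [Ring A] [HopfAlgebra k A] [FiniteDimensional k A]

instance ConvDual.finiteDimensional : FiniteDimensional k (ConvDual k A) :=
  Module.Finite.equiv (WithConv.linearEquiv k (A →ₗ[k] k)).symm

section

variable {W : Type u} [AddCommGroup W] [Module k W] [Module (ConvDual k A) W]
  [IsScalarTower k (ConvDual k A) W]

variable (k A W) in
lemma finiteDimensional_of_isSimpleModule [IsSimpleModule (ConvDual k A) W] :
    FiniteDimensional k W :=
  Module.Finite.trans (ConvDual k A) W

/-- The matrix coefficients `ξ(w₀) w₁` of `W`, evaluated at `φ`. -/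
lemma apply_coefficient (φ : ConvDual k A) (ξ : W →ₗ[k] k) (w : W) :
    φ.ofConv (TensorProduct.lid k A (ξ.rTensor A (coaction k A W w))) = ξ (φ • w) := by
  rw [← coaction_spec]
  generalize coaction k A W w = t
  induction t with
  | zero => simp
  | add x y hx hy => simp only [map_add, hx, hy]
  | tmul x y => simp [mul_comm]

lemma mem_coeffSpace {a : A} (ξ : W →ₗ[k] k) (w : W)
    (h : ∀ φ : ConvDual k A, φ.ofConv a = ξ (φ • w)) : a ∈ coeffSpace k A W :=
  Submodule.subset_span ⟨ξ, w, convDual_ext_apply (k := k) fun φ =>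
    (h φ).trans (apply_coefficient φ ξ w).symm⟩

end

variable {F : Type*} [Group F] [Fintype F] [DecidableEq F] {Q : F → ConvDual k A}

namespace CocentralGrading

variable (hQ : CocentralGrading Q)
include hQ

section

variable {W : Type u} [AddCommGroup W] [Module k W] [Module (ConvDual k A) W]

omit [FiniteDimensional k A] [Module k W] in
lemma sum_smul (w : W) : ∑ x, Q x • w = w := by
  rw [← Finset.sum_smul, hQ.sum_eq, one_smul]

omit [FiniteDimensional k A] [Module k W] in
lemma smul_smul_eq (x y : F) (w : W) : Q x • Q y • w = if x = y then Q x • w else 0 := by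
  rw [← mul_smul, hQ.mul_eq]
  split_ifs
  · rfl
  · exact zero_smul (ConvDual k A) w

omit [FiniteDimensional k A] [Module k W] in
/-- An irreducible module is concentrated in one degree. -/
lemma exists_smul_eq [IsSimpleModule (ConvDual k A) W] : ∃ x, ∀ w : W, Q x • w = w := by
  have := IsSimpleModule.nontrivial (ConvDual k A) W
  obtain ⟨w₀, hw₀⟩ := exists_ne (0 : W)
  obtain ⟨x, hx⟩ : ∃ x, Q x • w₀ ≠ 0 := by
    by_contra! h
    refine hw₀ ?_
    rw [← hQ.sum_smul w₀]
    exact Finset.sum_eq_zero fun x _ => h x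
  let P : Submodule (ConvDual k A) W :=
    { carrier := {w | Q x • w = w}
      add_mem' := fun {v w} hv hw => by
        rw [Set.mem_ofPred_eq] at *
        rw [smul_add, hv, hw]
      zero_mem' := smul_zero _
      smul_mem' := fun φ w hw => by
        rw [Set.mem_ofPred_eq] at *
        rw [← mul_smul, hQ.comm, mul_smul, hw] }
  have hP : P = ⊤ := by
    refine (eq_bot_or_eq_top P).resolve_left fun h => hx ?_
    have : Q x • w₀ ∈ P := by
      change Q x • Q x • w₀ = Q x • w₀
      rw [hQ.smul_smul_eq, if_pos rfl]
    rwa [h] at this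
  refine ⟨x, fun w => ?_⟩
  have : w ∈ P := hP ▸ Submodule.mem_top
  exact this

variable [IsScalarTower k (ConvDual k A) W]

omit hQ [Group F] [Fintype F] [DecidableEq F] in
lemma coeffSpace_le_part_iff (N : Set F) :
    coeffSpace k A W ≤ part Q N ↔ ∀ y ∉ N, ∀ w : W, Q y • w = 0 := by
  constructor
  · intro h y hy w
    rw [← Module.forall_dual_apply_eq_zero_iff k]
    intro ξ
    have h₁ := h (Submodule.subset_span ⟨ξ, w, rfl⟩) y hy
    rw [← apply_coefficient, ← counit_lAct, h₁, map_zero]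
  · intro h
    refine Submodule.span_le.2 ?_
    rintro _ ⟨ξ, w, rfl⟩ y hy
    refine convDual_ext_apply (k := k) fun φ => ?_
    rw [← convDual_mul_apply_lAct, apply_coefficient, mul_smul, h y hy, smul_zero, map_zero,
      map_zero]

end

omit hQ in
/-- The left ideal of `A^*` generated by the idempotent of the degrees in `N`. -/
abbrev idemIdeal (Q : F → ConvDual k A) (N : Set F) : Submodule (ConvDual k A) (ConvDual k A) :=
  Submodule.span (ConvDual k A) {idem Q N}

omit [FiniteDimensional k A] in
lemma smul_idemIdeal (N : Set F) {y : F} (hy : y ∉ N) (w : idemIdeal Q N) : Q y • w = 0 := by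
  classical
  obtain ⟨w, hw⟩ := w
  obtain ⟨φ, rfl⟩ := Submodule.mem_span_singleton.1 hw
  ext1
  change Q y * (φ * idem Q N) = 0
  rw [← mul_assoc, hQ.comm, mul_assoc, hQ.mul_idem, if_neg hy, mul_zero]

/-- An element `a` of the part over `N` is the coefficient of the generator `idem Q N` at the
functional `φ ↦ φ(a)`. -/
lemma part_le_coeffSpace (N : Set F) : part Q N ≤ coeffSpace k A (idemIdeal Q N) := by
  intro a ha
  let ξ : idemIdeal Q N →ₗ[k] k := LinearMap.applyₗ a ∘ₗ
    (WithConv.linearEquiv k (A →ₗ[k] k)).toLinearMap ∘ₗ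
      (idemIdeal Q N).subtype.restrictScalars k
  refine mem_coeffSpace ξ ⟨idem Q N, Submodule.mem_span_singleton_self _⟩ fun φ => ?_
  exact (hQ.apply_mul_idem ha φ).symm

/-- Every degree `x` with `q x ≠ 0` supports an irreducible module: a minimal left ideal of
`A^*` inside `A^* q x`. -/
lemma exists_isSimpleModule {x : F} (hx : Q x ≠ 0) :
    ∃ I : Submodule (ConvDual k A) (ConvDual k A), IsSimpleModule (ConvDual k A) I ∧
      ∀ w : I, Q x • w = w := by
  have : IsArtinian (ConvDual k A) (ConvDual k A) := isArtinian_of_tower k inferInstance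
  have hne : Submodule.span (ConvDual k A) {Q x} ≠ ⊥ := by
    rwa [Ne, Submodule.span_singleton_eq_bot]
  obtain ⟨I, hI, hle⟩ := (eq_bot_or_exists_atom_le _).resolve_left hne
  refine ⟨I, isSimpleModule_iff_isAtom.2 hI, fun w => ?_⟩
  obtain ⟨φ, hφ⟩ := Submodule.mem_span_singleton.1 (hle w.2)
  ext1
  change Q x * (w : ConvDual k A) = w
  rw [← hφ, smul_eq_mul, ← mul_assoc, hQ.comm, mul_assoc, hQ.mul_eq, if_pos rfl]

end CocentralGrading

end Modules

/-! ### Conjugates and stabilizers -/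

namespace GenDouble

section Conjugates

variable {k U H : Type u} [Field k] [Ring U] [HopfAlgebra k U] [FiniteDimensional k U] [Ring H]
  [HopfAlgebra k H] [FiniteDimensional k H] {f : U →ₐc[k] DualCop k H} {G F : Type*}
  [Group G] [Fintype G] [DecidableEq G] [Group F] [Fintype F] [DecidableEq F]
  {eG : (G → k) →ₐ[k] U} {eF : (F → k) →ₐ[k] DualCop k H} {s : F →* G}
  (heG : IsDualGroupEmbedding eG) (hs : ∀ φ, f (eG φ) = eF (φ ∘ s))
  (hq : CocentralGrading (degreeFunctional eF)) (hc : eG.range ≤ Subalgebra.center k U)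
  (hN : IsNormalHopfSubalgebra (ofGroup f eG).range)
  (he : Function.Injective (ofGroup f eG)) (g : G)

section

variable (W : Type u) [AddCommGroup W] [Module k W] [Module (ConvDual k (GenDouble f)) W]
  [IsScalarTower k (ConvDual k (GenDouble f)) W]

include heG hs hq hc

/-- On the component of `W` of degree `y`, functions on `G` act on `W ⊗ k p_g` through their value
at the conjugate of `g` by `(s y)⁻¹`. -/
lemma conjAction_ofGroup (φ : G → k) :
    conjAction W hN (groupRep (ofGroup f eG) he g) ⟨ofGroup f eG φ, φ, rfl⟩ =
      ∑ y, φ ((s y)⁻¹ * g * s y) •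
        (Algebra.lsmul k k W (extend f (degreeFunctional eF y))).rTensor k := by
  have hadj : ∀ (a : GenDouble f) (c : k),
      groupRep (ofGroup f eG) he g (adjOn hN ⟨ofGroup f eG φ, φ, rfl⟩ a) c =
        (∑ y, (extend f (degreeFunctional eF y)).ofConv a * φ ((s y)⁻¹ * g * s y)) * c := by
    intro a c
    have h : adjOn hN ⟨ofGroup f eG φ, φ, rfl⟩ a = ⟨ofGroup f eG
        (∑ y, (extend f (degreeFunctional eF y)).ofConv a • fun h => φ ((s y)⁻¹ * h * s y)),
        _, rfl⟩ := by
      ext1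
      refine (rightAdj_ofGroup heG hs hq hc φ a).trans ?_
      simp only [map_sum, map_smul]
    rw [h, groupRep_apply]
    simp [Finset.sum_apply]
  apply TensorProduct.ext'
  intro w c
  have key : ∀ t : W ⊗[k] GenDouble f,
      (TensorProduct.lift ((groupRep (ofGroup f eG) he g).toLinearMap ∘ₗ
        adjOn hN ⟨ofGroup f eG φ, φ, rfl⟩)).lTensor W (TensorProduct.assoc k W _ k (t ⊗ₜ c)) =
      ∑ y, φ ((s y)⁻¹ * g * s y) • (TensorProduct.rid k W
        ((extend f (degreeFunctional eF y)).ofConv.lTensor W t) ⊗ₜ c) := by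
    intro t
    induction t with
    | zero => simp
    | add x y hx hy =>
      simp only [add_tmul, map_add, smul_add, Finset.sum_add_distrib, hx, hy]
    | tmul w a =>
      simp only [assoc_tmul, LinearMap.lTensor_tmul, lift.tmul, LinearMap.comp_apply,
        AlgHom.toLinearMap_apply, hadj, rid_tmul]
      rw [← smul_eq_mul, tmul_smul, Finset.sum_smul]
      refine Finset.sum_congr rfl fun y _ => ?_
      rw [smul_tmul', smul_tmul', smul_smul, mul_comm]
  refine (key (coaction k (GenDouble f) W w)).trans ?_
  simp [coaction_spec, LinearMap.sum_apply]

lemma conjAction_of_smul_eq {x : F}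
    (hx : ∀ w : W, extend f (degreeFunctional eF x) • w = w) (φ : G → k) (t : W ⊗[k] k) :
    conjAction W hN (groupRep (ofGroup f eG) he g) ⟨ofGroup f eG φ, φ, rfl⟩ t =
      φ ((s x)⁻¹ * g * s x) • t := by
  have hQ := cocentralGrading_extend (f := f) hq
  rw [conjAction_ofGroup heG hs hq hc, LinearMap.sum_apply, Finset.sum_eq_single x]
  · rw [LinearMap.smul_apply]
    congr 1
    induction t with
    | zero => simp
    | add x y hx hy => simp only [map_add, hx, hy]
    | tmul w c => simp [hx]
  · intro y _ hy
    rw [LinearMap.smul_apply]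
    induction t with
    | zero => simp
    | add x y hx hy => simp only [map_add, smul_add, hx, hy, add_zero]
    | tmul w c =>
      have h := hQ.smul_smul_eq y x w
      rw [hx, if_neg hy] at h
      simp [h]
  · simp

lemma conjugateIsMultipleOf [FiniteDimensional k W] {x : F}
    (hx : ∀ w : W, extend f (degreeFunctional eF x) • w = w) {h : G}
    (hh : h = (s x)⁻¹ * g * s x) :
    ConjugateIsMultipleOf W hN (groupRep (ofGroup f eG) he g) (groupRep (ofGroup f eG) he h) := by
  refine ⟨(TensorProduct.rid k W).trans (Module.finBasis k W).equivFun, ?_⟩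
  rintro ⟨_, φ, rfl⟩ t i
  refine (congrArg (fun t => (((TensorProduct.rid k W).trans
    (Module.finBasis k W).equivFun) t) i)
      (conjAction_of_smul_eq heG hs hq hc hN he g W hx φ t)).trans ?_
  refine Eq.trans ?_ (groupRep_apply _ he h φ _).symm
  rw [map_smul, hh]
  rfl

/-- The module `W` stabilizes `g` if and only if its components of degree `y` with `s y` outside
the centralizer of `g` vanish: the trace of `p_g` on `W ⊗ k p_g` is the dimension of the sum of the
other components. -/
lemma stabilizes_iff [CharZero k] [FiniteDimensional k W] :
    Stabilizes W hN (groupRep (ofGroup f eG) he g) ↔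
      ∀ y ∉ {x | s x ∈ Subgroup.centralizer {g}}, ∀ w : W,
        extend f (degreeFunctional eF y) • w = 0 := by
  classical
  have hQ := cocentralGrading_extend (f := f) hq
  have hmem : ∀ y, y ∈ {x | s x ∈ Subgroup.centralizer {g}} ↔ (s y)⁻¹ * g * s y = g := by
    intro y
    change s y ∈ Subgroup.centralizer {g} ↔ _
    rw [Subgroup.mem_centralizer_singleton_iff, mul_assoc, inv_mul_eq_iff_eq_mul]
    exact eq_comm
  have htr : ∀ φ : G → k, LinearMap.trace k (W ⊗[k] k)
      (conjAction W hN (groupRep (ofGroup f eG) he g) ⟨ofGroup f eG φ, φ, rfl⟩) =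
      ∑ y, φ ((s y)⁻¹ * g * s y) *
        LinearMap.trace k W (Algebra.lsmul k k W (extend f (degreeFunctional eF y))) := by
    intro φ
    rw [conjAction_ofGroup heG hs hq hc, map_sum]
    refine Finset.sum_congr rfl fun y _ => ?_
    rw [map_smul, LinearMap.rTensor, LinearMap.trace_tensorProduct']
    simp
  have htr' : ∀ φ : G → k, LinearMap.trace k k
      (groupRep (ofGroup f eG) he g ⟨ofGroup f eG φ, φ, rfl⟩) = φ g := by
    intro φ
    have h : groupRep (ofGroup f eG) he g ⟨ofGroup f eG φ, φ, rfl⟩ = φ g • LinearMap.id := by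
      ext
      exact groupRep_apply _ he g φ 1
    rw [h, map_smul]
    simp
  constructor
  · intro h
    have h₁ := h ⟨ofGroup f eG (Pi.single g 1), _, rfl⟩
    rw [htr, htr', Pi.single_eq_same, mul_one] at h₁
    set N := {x | s x ∈ Subgroup.centralizer {g}}
    -- the trace of this idempotent of `End W` is the dimension of `W`, so it is the identity
    have h₂ : LinearMap.trace k W (Algebra.lsmul k k W
        (CocentralGrading.idem (fun x => extend f (degreeFunctional eF x)) N)) =
        Module.finrank k W := by
      rw [← h₁, CocentralGrading.idem, map_sum, map_sum, Finset.sum_filter]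
      refine Finset.sum_congr rfl fun y _ => ?_
      rw [Pi.single_apply]
      simp only [hmem]
      split_ifs <;> simp
    have h₃ : (1 - Algebra.lsmul k k W
        (CocentralGrading.idem (fun x => extend f (degreeFunctional eF x)) N)) = 0 := by
      refine (LinearMap.IsIdempotentElem.trace_eq_zero_iff ?_).1 ?_
      · refine IsIdempotentElem.one_sub ?_
        rw [IsIdempotentElem, ← map_mul, hQ.idem_mul_idem]
      · rw [map_sub, h₂, LinearMap.trace_one, sub_self]
    intro y hy w
    have hw : CocentralGrading.idem (fun x => extend f (degreeFunctional eF x)) N • w = w :=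
      congr($((sub_eq_zero.1 h₃).symm) w)
    rw [← hw, ← mul_smul, hQ.mul_idem, if_neg hy]
    exact zero_smul (ConvDual k (GenDouble f)) w
  · rintro h ⟨_, φ, rfl⟩
    have h₁ : (Module.finrank k W : k) = ∑ y,
        LinearMap.trace k W (Algebra.lsmul k k W (extend f (degreeFunctional eF y))) := by
      rw [← map_sum, ← map_sum, hQ.sum_eq, map_one, LinearMap.trace_one]
    refine (htr φ).trans ?_
    refine Eq.trans ?_ (congrArg _ (htr' φ)).symm
    rw [h₁, Finset.sum_mul]
    refine Finset.sum_congr rfl fun y _ => ?_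
    by_cases hy : y ∈ {x | s x ∈ Subgroup.centralizer {g}}
    · rw [(hmem y).1 hy, mul_comm]
    · have : Algebra.lsmul k k W (extend f (degreeFunctional eF y)) = 0 := by
        ext w
        exact h y hy w
      rw [this, map_zero, mul_zero, zero_mul]

end

include heG hs hq hc

lemma isConjugate_iff (heF : Function.Injective eF) (h : G) :
    IsConjugate hN (groupRep (ofGroup f eG) he g) (groupRep (ofGroup f eG) he h) ↔
      ∃ x, h = (s x)⁻¹ * g * s x := by
  have hQ := cocentralGrading_extend (f := f) hq
  constructor
  · rintro ⟨W, _, _, _, _, hW, j, hj, hj'⟩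
    obtain ⟨x, hx⟩ := hQ.exists_smul_eq (W := W)
    refine ⟨x, ?_⟩
    have h₁ := (hj' ⟨ofGroup f eG (Pi.single h 1), _, rfl⟩ 1).trans
      (conjAction_of_smul_eq heG hs hq hc hN he g W hx _ _)
    rw [groupRep_apply, Pi.single_eq_same, mul_one, ← map_smul] at h₁
    have h₂ := hj h₁
    by_contra hne
    rw [Pi.single_eq_of_ne (Ne.symm hne), zero_smul] at h₂
    exact one_ne_zero h₂
  · rintro ⟨x, rfl⟩
    have hne : extend f (degreeFunctional eF x) ≠ 0 := by
      intro h₀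
      have h₁ : eF (Pi.single x 1) = 0 := by
        apply DualCop.toDual.injective
        ext a
        have h₂ := congr(($h₀).ofConv (mk f 1 a))
        rw [extend_mk, Bialgebra.counit_one, one_mul] at h₂
        exact h₂
      have h₂ := heF (h₁.trans (map_zero eF).symm)
      exact one_ne_zero (α := k) (by simpa using congrFun h₂ x)
    obtain ⟨I, hI, hx⟩ := hQ.exists_isSimpleModule hne
    refine ⟨I, inferInstance, inferInstance, inferInstance, inferInstance, hI, ?_⟩
    have := IsSimpleModule.nontrivial (ConvDual k (GenDouble f)) I
    obtain ⟨w, hw⟩ := exists_ne (0 : I)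
    refine ⟨TensorProduct.mk k I k w, ?_, ?_⟩
    · rw [injective_iff_map_eq_zero]
      intro c h₀
      have h₁ := congrArg (TensorProduct.rid k I) h₀
      rw [TensorProduct.mk_apply, rid_tmul, LinearEquiv.map_zero] at h₁
      exact (smul_eq_zero.1 h₁).resolve_right hw
    · rintro ⟨_, φ, rfl⟩ c
      refine Eq.trans ?_ (conjAction_of_smul_eq heG hs hq hc hN he g I hx φ _).symm
      rw [← map_smul]
      exact congrArg _ (groupRep_apply _ he _ φ c)

/-- The stabilizer is the homogeneous part of the double over the degrees `x` such that `s x`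
centralizes `g`. The left ideal of `A^*` generated by the corresponding idempotent stabilizes `g` and
has this part as its coefficient coalgebra. -/
lemma stabilizer_eq [CharZero k] : stabilizer hN (groupRep (ofGroup f eG) he g) =
    CocentralGrading.part (fun x => extend f (degreeFunctional eF x))
      {x | s x ∈ Subgroup.centralizer {g}} := by
  have hQ := cocentralGrading_extend (f := f) hq
  apply le_antisymm
  · refine sSup_le ?_
    rintro _ ⟨W, _, _, _, _, _, hW, rfl⟩
    rw [CocentralGrading.coeffSpace_le_part_iff]
    exact (stabilizes_iff heG hs hq hc hN he g W).1 hW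
  · refine (hQ.part_le_coeffSpace _).trans (le_sSup ?_)
    refine ⟨_, inferInstance, inferInstance, inferInstance, inferInstance, ?_, ?_, rfl⟩
    · infer_instance
    · exact (stabilizes_iff heG hs hq hc hN he g _).2 fun y hy w => hQ.smul_idemIdeal _ hy w

end Conjugates

end GenDouble
end

theorem theorem3p14 {k U H : Type u} [Field k] [IsAlgClosed k] [CharZero k]
    [Ring U] [HopfAlgebra k U] [FiniteDimensional k U] [IsSemisimpleRing U]
    [Ring H] [HopfAlgebra k H] [FiniteDimensional k H] [IsSemisimpleRing H]
    (f : U →ₐc[k] DualCop k H) (hf : Function.Surjective f)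
    {G F : Type*} [Group G] [Fintype G] [DecidableEq G] [Group F] [Fintype F] [DecidableEq F]
    (eG : (G → k) →ₐ[k] U) (heG : IsDualGroupEmbedding eG) (hKG : IsHopfCentre eG.range)
    (eF : (F → k) →ₐ[k] DualCop k H) (heF : IsDualGroupEmbedding eF)
    (hKF : IsHopfCentre eF.range) :
    ∃ fStar : F →* G,
      (∀ g : G, f (eG (Pi.single g 1)) = ∑ x with fStar x = g, eF (Pi.single x 1)) ∧
      ∃ hN : IsNormalHopfSubalgebra (GenDouble.ofGroup f eG).range, ∀ g : G,
        -- the conjugates of `g` are the `f^*(x) g f^*(x)⁻¹`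
        ({h : G | IsConjugate hN
            (groupRep _ (GenDouble.ofGroup_injective f heG.injective) g)
            (groupRep _ (GenDouble.ofGroup_injective f heG.injective) h)} =
          Set.range fun x : F => fStar x * g * (fStar x)⁻¹) ∧
        -- each conjugate module by an irreducible `A^*`-module is a multiple of one conjugate
        (∀ (W : Type u) [AddCommGroup W] [Module k W] [Module (ConvDual k (GenDouble f)) W]
            [IsScalarTower k (ConvDual k (GenDouble f)) W],
          IsSimpleModule (ConvDual k (GenDouble f)) W →
          ∃ x : F, ConjugateIsMultipleOf W hN
            (groupRep _ (GenDouble.ofGroup_injective f heG.injective) g)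
            (groupRep _ (GenDouble.ofGroup_injective f heG.injective)
              (fStar x * g * (fStar x)⁻¹))) ∧
        -- the stabilizer of `g` is `U ⋈ L(g)`
        ∃ L : Subalgebra k H,
          (IsSubalgebraOfComponents eF {x | fStar x ∈ Subgroup.centralizer {g}} L ∧
            ∀ L' : Subalgebra k H,
              IsSubalgebraOfComponents eF {x | fStar x ∈ Subgroup.centralizer {g}} L' → L' = L) ∧
          ∃ Z : Subalgebra k (GenDouble f), IsHopfSubalgebra Z ∧
            Z.toSubmodule = stabilizer hN
              (groupRep _ (GenDouble.ofGroup_injective f heG.injective) g) ∧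
            (∀ (W : Type u) [AddCommGroup W] [Module k W] [Module (ConvDual k (GenDouble f)) W]
                [IsScalarTower k (ConvDual k (GenDouble f)) W],
              IsSimpleModule (ConvDual k (GenDouble f)) W →
              (coeffSpace k (GenDouble f) W ≤ Z.toSubmodule ↔ Stabilizes W hN
                (groupRep _ (GenDouble.ofGroup_injective f heG.injective) g))) ∧
            Z.toSubmodule = GenDouble.bowtie f L := by
  have hq := cocentralGrading_degreeFunctional heF hKF.1.2
  have hc := hKG.1.2
  obtain ⟨s, hs⟩ := heG.exists_monoidHom f heF (hKG.map_le hf hKF)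
  have hQ := GenDouble.cocentralGrading_extend (f := f) hq
  have hN := GenDouble.isNormalHopfSubalgebra_ofGroup heG hs hq hc
  refine ⟨s, ?_, hN, fun g => ⟨?_, ?_, ?_⟩⟩
  · intro g
    rw [hs, algHom_eq_sum_single, Finset.sum_filter]
    refine Finset.sum_congr rfl fun x _ => ?_
    rw [Function.comp_apply, Pi.single_apply]
    split_ifs <;> simp
  · ext h
    refine (GenDouble.isConjugate_iff heG hs hq hc hN _ g heF.injective h).trans ?_
    -- modules of degree `x` conjugate by `(s x)⁻¹`
    constructor
    · rintro ⟨x, rfl⟩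
      exact ⟨x⁻¹, by simp⟩
    · rintro ⟨x, rfl⟩
      exact ⟨x⁻¹, by simp⟩
  · intro W _ _ _ _ hW
    have := finiteDimensional_of_isSimpleModule k (GenDouble f) W
    obtain ⟨x, hx⟩ := hQ.exists_smul_eq (W := W)
    exact ⟨x⁻¹, GenDouble.conjugateIsMultipleOf heG hs hq hc hN _ g W hx (by simp)⟩
  · let N : Subgroup F := (Subgroup.centralizer {g}).comap s
    have hL := isSubalgebraOfComponents_part heF hKF.1.2 N
    have hst := GenDouble.stabilizer_eq heG hs hq hc hN
      (GenDouble.ofGroup_injective f heG.injective) g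
    refine ⟨hq.partSubalgebra N, ⟨hL, fun L' hL' => IsSubalgebraOfComponents.unique hL' hL⟩,
      hQ.partSubalgebra N, hQ.isHopfSubalgebra_part N, hst.symm, ?_, ?_⟩
    · intro W _ _ _ _ hW
      have := finiteDimensional_of_isSimpleModule k (GenDouble f) W
      rw [GenDouble.stabilizes_iff heG hs hq hc hN]
      exact CocentralGrading.coeffSpace_le_part_iff _
    · exact GenDouble.part_extend hq _ rfl
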